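/- **Setup.** There are $N$ users and $L\le N$ providers; $\mathcal A$ is the set of all these agents. An agent $a$ can be matched to an agent $a'$ of the other side or to nobody ($\emptyset$). Its true preferences $\mu(a,\cdot)\ge 0$ have no ties and satisfy $\mu(a,\emptyset)=0$. A matching is feasible if matches are mutual and every provider is matched to exactly one user and every user to at most one provider. Given payoffs $V(a,a')$, a feasible matching $m$ is stable if there is no user–provider pair $(u,p)$ with $V(u,m(u))<V(u,p)$ and $V(p,m(p))<V(p,u)$; $S(V)$ is the set of stable matchings. If $a$ is matched to $a'\neq\emptyset$ at time $t\ge1$ it receives a reward $X_t(a,a')$ with mean $\mu(a,a')$ and $\sigma^2$-sub-Gaussian law; if it is unmatched it receives $X_t(a,\emptyset)=0$. Each pair starts with $T_0(a,a')=T_0(a',a)\ge1$ initial samples per agent with the same law, and all rewards and initial samples are independent. At time $t$ the agents report $\nu_t(a,a')=\hat\mu_t(a,a')+\sqrt{2\sigma^2\alpha\log t/T_{t-1}(a,a')}$ and $\nu_t(a,\emptyset)=0$, where $\alpha>2$, $T_{t-1}(a,a')$ is the number of samples of $a'$ obtained by $a$ before time $t$ (the initial ones included) and $\hat\mu_t(a,a')$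 is their mean. A matching mechanism $\mathcal M$ is a (measurable) function of $\nu_t$, choosing the matching $\mathcal M(\cdot;\nu_t)$. There are no costs and no transfers, so the payoffs under preferences $\psi$ are $V(\cdot,\cdot;\psi)=\psi$. "The Gale–Shapley algorithm is applied" means that $\mathcal M(\cdot;\nu_t)$ is always a matching returned by the provider-proposing Gale–Shapley algorithm on $\nu_t$ (ties broken arbitrarily). The system is incentive-compatible up to $T$ if $\mathcal M(\cdot;\nu_t)\in S(\nu_t)$ for all $1\le t\le T$. The optimal regret of $a$ at horizon $T$ is $\overline R_T(a)=\mathbb E\sum_{t=1}^T\big(X_t(a,\overline m(a))-X_t(a,\mathcal M(a;\nu_t))\big)$, where $\overline m\in S(\mu)$ maximizes the expected payoff of $a$ over $S(\mu)$; the pessimal regret $\underline R_T(a)$ is the same with a minimizer. The mechanism is unfair if some agent has optimal regret $O(\log T)$ and another one $\omega(\log T)$. Social welfare is high up to $T$ if, for all $1\le t\le T$, $\sum_{a}\nu_t(a,\mathcal M(a;\nu_t))\ge\frac12\max_m\sum_a\nu_t(a,m(a))$, the maximum being over the feasible matchings. Let $\Delta_{\max}(a)=\max_{b,c}(\mu(a,b)-\mu(a,c))$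 and $\Delta_{\min}=\min_{a,\,b\ne c}|\mu(a,b)-\mu(a,c)|$, where $b,c$ range over the possible matches of $a$, including $\emptyset$. **Proposition.** 1. If the Gale–Shapley algorithm is applied at all times $1\le t\le T$ (with $T\ge1$), then the system is incentive-compatible up to $T$, and for all $a\in\mathcal A$ $$\underline R_T(a)\le 2N^2L\,\Delta_{\max}(a)\left(\frac{8\sigma^2\alpha\log T}{\Delta_{\min}^2}+\frac{\alpha}{\alpha-2}\right).$$ 2. There is a market $(\mathcal A,\mu)$ with three users, three providers and exactly two stable matchings in $S(\mu)$ such that: - (optimal regret and fairness) some mechanism applies the Gale–Shapley algorithm to every preference profile; and for all $\sigma,\alpha,T_0$, all reward laws and every mechanism that applies the Gale–Shapley algorithm at all times, at least one agent has optimal regret $\Omega(T)$, and the mechanism is unfair; - (optimal regret under incentive compatibility) for all $\sigma,\alpha,T_0$, all reward laws and every mechanism that is incentive-compatible at all times, $\max_{a}\overline R_T(a)=\Omega(T)$; - (social welfare) for all $\sigma,\alpha,T_0$ there are reward laws such that, for every $T\ge1$ and every mechanism that is incentive-compatible up to $T$, almost surely the social welfare is not high up to $T$. -/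

import Mathlib

open MeasureTheory ProbabilityTheory Filter Finset
open scoped NNReal

namespace MatchingBandits

noncomputable section

/-- The agents: `N` users (`Sum.inl`) and `L` providers (`Sum.inr`). -/
abbrev Agent (N L : ℕ) : Type := Fin N ⊕ Fin L

/-- The agents on the other side of the market from `a`. -/
abbrev Partner {N L : ℕ} : Agent N L → Type
  | Sum.inl _ => Fin L
  | Sum.inr _ => Fin N

instance instFintypePartner {N L : ℕ} : (a : Agent N L) → Fintype (Partner a)
  | Sum.inl _ => inferInstanceAs (Fintype (Fin L))
  | Sum.inr _ => inferInstanceAs (Fintype (Fin N))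

instance instDecidableEqPartner {N L : ℕ} : (a : Agent N L) → DecidableEq (Partner a)
  | Sum.inl _ => inferInstanceAs (DecidableEq (Fin L))
  | Sum.inr _ => inferInstanceAs (DecidableEq (Fin N))

/-- A real-valued function of an agent and of a potential match of that agent; `none` stands
for no agent. Used for preferences, payoffs, costs and transfers. -/
abbrev Pref (N L : ℕ) : Type := (a : Agent N L) → Option (Partner a) → ℝ

/-- An assignment of a match (or of nobody) to each agent. -/
abbrev Assignment (N L : ℕ) : Type := (a : Agent N L) → Option (Partner a)

/-- Feasible matchings: matches are mutual (so one-to-one), and every provider is matched. -/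
def Feasible {N L : ℕ} (m : Assignment N L) : Prop :=
  (∀ (u : Fin N) (p : Fin L), m (Sum.inl u) = some p ↔ m (Sum.inr p) = some u) ∧
    ∀ p : Fin L, m (Sum.inr p) ≠ none

/-- The pair `(u, p)` blocks `m`: both strictly prefer each other to their matches. -/
def Blocks {N L : ℕ} (V : Pref N L) (m : Assignment N L) (u : Fin N) (p : Fin L) : Prop :=
  V (Sum.inl u) (m (Sum.inl u)) < V (Sum.inl u) (some p) ∧
    V (Sum.inr p) (m (Sum.inr p)) < V (Sum.inr p) (some u)

/-- The set of stable matchings under payoffs `V`. -/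
def stableSet {N L : ℕ} (V : Pref N L) : Set (Assignment N L) :=
  {m | Feasible m ∧ ∀ u p, ¬ Blocks V m u p}

/-! ### Gale–Shapley with providers as proposers -/

/-- State of the algorithm: the current assignment and the queue of each provider. -/
abbrev GSState (N L : ℕ) : Type := Assignment N L × (Fin L → List (Fin N))

/-- `l` lists all the users in order of decreasing preference of `p` (ties in any order). -/
def IsRanking {N L : ℕ} (V : Pref N L) (p : Fin L) (l : List (Fin N)) : Prop :=
  l.Nodup ∧ (∀ u, u ∈ l) ∧
    l.Pairwise (fun u u' => V (Sum.inr p) (some u') ≤ V (Sum.inr p) (some u))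

/-- Match `u` and `p` in `m`. -/
def pair {N L : ℕ} (m : Assignment N L) (u : Fin N) (p : Fin L) : Assignment N L :=
  Function.update (Function.update m (Sum.inl u) (some p)) (Sum.inr p) (some u)

/-- One pass through the loop: an unmatched provider `p` proposes to the head `u` of its queue,
and `u` accepts if it is unmatched or if it strictly prefers `p` to its current match. -/
inductive GSStep {N L : ℕ} (V : Pref N L) : GSState N L → GSState N L → Prop
  | accept (m : Assignment N L) (Q : Fin L → List (Fin N)) (p : Fin L) (u : Fin N)
      (q : List (Fin N)) (hp : m (Sum.inr p) = none) (hQ : Q p = u :: q)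
      (hu : m (Sum.inl u) = none) :
      GSStep V (m, Q) (pair m u p, Function.update Q p q)
  | swap (m : Assignment N L) (Q : Fin L → List (Fin N)) (p p' : Fin L) (u : Fin N)
      (q : List (Fin N)) (hp : m (Sum.inr p) = none) (hQ : Q p = u :: q)
      (hu : m (Sum.inl u) = some p')
      (hV : V (Sum.inl u) (some p') < V (Sum.inl u) (some p)) :
      GSStep V (m, Q) (pair (Function.update m (Sum.inr p') none) u p, Function.update Q p q)
  | reject (m : Assignment N L) (Q : Fin L → List (Fin N)) (p p' : Fin L) (u : Fin N)
      (q : List (Fin N)) (hp : m (Sum.inr p) = none) (hQ : Q p = u :: q)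
      (hu : m (Sum.inl u) = some p')
      (hV : V (Sum.inl u) (some p) ≤ V (Sum.inl u) (some p')) :
      GSStep V (m, Q) (m, Function.update Q p q)

/-- `m` is returned by some run of the algorithm over payoffs `V`: the run starts with nobody
matched and full sorted queues, and stops when all the providers are matched. -/
def IsGSOutput {N L : ℕ} (V : Pref N L) (m : Assignment N L) : Prop :=
  ∃ Q₀ Q : Fin L → List (Fin N), (∀ p, IsRanking V p (Q₀ p)) ∧
    Relation.ReflTransGen (GSStep V) (fun _ => none, Q₀) (m, Q) ∧
    ∀ p, m (Sum.inr p) ≠ none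

/-! ### Markets, rewards, costs and transfers -/

/-- True preferences: nonnegative, zero for being unmatched, without ties. -/
structure Market (N L : ℕ) where
  le : L ≤ N
  μ : Pref N L
  μ_nonneg : ∀ a b, 0 ≤ μ a b
  μ_none : ∀ a, μ a none = 0
  μ_injective : ∀ a, Function.Injective (μ a)

/-- `Δ_max(a)`. -/
def Market.gapMax {N L : ℕ} (K : Market N L) (a : Agent N L) : ℝ :=
  sSup {d | ∃ b c : Option (Partner a), d = K.μ a b - K.μ a c}

/-- `Δ_min`. -/
def Market.gapMin {N L : ℕ} (K : Market N L) : ℝ :=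
  sInf {d | ∃ (a : Agent N L) (b c : Option (Partner a)), b ≠ c ∧ d = |K.μ a b - K.μ a c|}

/-- The number of initial samples, given for each user-provider pair, as seen by an agent. -/
def initCount {N L : ℕ} (T₀ : Fin N → Fin L → ℕ) : (a : Agent N L) → Partner a → ℕ
  | Sum.inl u => fun p => T₀ u p
  | Sum.inr p => fun u => T₀ u p

/-- The random environment on a probability space `(Ω, P)`: the initial samples `X₀ τ a b`
(`1 ≤ τ ≤ T₀`) and the rewards `X t a b` (`t ≥ 1`) are independent, with law `D a b`,
`σ²`-sub-Gaussian with mean `μ a b`; `α` is the parameter of the confidence bounds. -/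
structure Environment {N L : ℕ} (K : Market N L) {Ω : Type*} [MeasurableSpace Ω]
    (P : Measure Ω) where
  σ : ℝ≥0
  α : ℝ
  two_lt_α : 2 < α
  T₀ : Fin N → Fin L → ℕ
  T₀_pos : ∀ u p, 0 < T₀ u p
  D : (a : Agent N L) → Partner a → Measure ℝ
  mean_D : ∀ a b, ∫ x, x ∂(D a b) = K.μ a (some b)
  subgaussian_D : ∀ a b, HasSubgaussianMGF (fun x : ℝ => x - K.μ a (some b)) (σ ^ 2) (D a b)
  X₀ : ℕ → (a : Agent N L) → Partner a → Ω → ℝ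
  X : ℕ → (a : Agent N L) → Partner a → Ω → ℝ
  measurable_X₀ : ∀ τ a b, Measurable (X₀ τ a b)
  measurable_X : ∀ t a b, Measurable (X t a b)
  law_X₀ : ∀ τ a b, P.map (X₀ τ a b) = D a b
  law_X : ∀ t a b, P.map (X t a b) = D a b
  indep : iIndepFun
    (fun (i : (ℕ ⊕ ℕ) × (Σ a : Agent N L, Partner a)) => Sum.elim X₀ X i.1 i.2.1 i.2.2) P

/-- A matching mechanism: a (measurable) function of the reported transient preferences. -/
structure Mechanism (N L : ℕ) where
  toFun : Pref N L → Assignment N L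
  measurable : ∀ m, MeasurableSet {ψ | toFun ψ = m}

/-- A cost or transfer rule, as a function of the information state. -/
abbrev Rule (N L : ℕ) : Type := Pref N L → Pref N L

/-- The rule without any cost, or without any transfer. -/
def zeroRule {N L : ℕ} : Rule N L := fun _ _ _ => 0

/-- The payoffs `V(a, a'; ψ) = ψ(a, a') - C(a, a'; ψ) + R(a, a'; ψ)`, under the cost rule `C`
and the transfer rule `R`. -/
def payoff {N L : ℕ} (C R : Rule N L) (ψ : Pref N L) : Pref N L :=
  fun a b => ψ a b - C ψ a b + R ψ a b

variable {N L : ℕ} {K : Market N L} {Ω : Type*} [MeasurableSpace Ω] {P : Measure Ω}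

/-! ### The matching process -/

/-- For all ordered pairs, the number of samples so far and their sum. -/
structure Stats (N L : ℕ) where
  count : (a : Agent N L) → Partner a → ℕ
  total : (a : Agent N L) → Partner a → ℝ

/-- The upper confidence bounds reported at time `t`, given the samples up to time `t - 1`. -/
def Environment.ucb (E : Environment K P) (t : ℕ) (s : Stats N L) : Pref N L :=
  fun a b => match b with
    | none => 0
    | some b => s.total a b / s.count a b +
        Real.sqrt (2 * (E.σ : ℝ) ^ 2 * E.α * Real.log t / s.count a b)

/-- The samples up to time `t`, including the initial ones. -/
def Environment.stats (E : Environment K P) (M : Mechanism N L) (ω : Ω) : ℕ → Stats N L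
  | 0 =>
    { count := initCount E.T₀
      total := fun a b => ∑ τ ∈ Icc 1 (initCount E.T₀ a b), E.X₀ τ a b ω }
  | t + 1 =>
    let s := Environment.stats E M ω t
    let m := M.toFun (E.ucb (t + 1) s)
    { count := fun a b => s.count a b + if m a = some b then 1 else 0
      total := fun a b => s.total a b + if m a = some b then E.X (t + 1) a b ω else 0 }

/-- The transient preferences `ν_t`, for `t ≥ 1`. -/
def Environment.ν (E : Environment K P) (M : Mechanism N L) (t : ℕ) (ω : Ω) : Pref N L :=
  E.ucb t (E.stats M ω (t - 1))

/-- The matching chosen at time `t ≥ 1`. -/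
def Environment.matching (E : Environment K P) (M : Mechanism N L) (t : ℕ) (ω : Ω) :
    Assignment N L :=
  M.toFun (E.ν M t ω)

/-- The count is the initial count plus the number of times the pair was matched. -/
theorem Environment.stats_count (E : Environment K P) (M : Mechanism N L) (ω : Ω) (t : ℕ)
    (a : Agent N L) (b : Partner a) :
    (E.stats M ω t).count a b = initCount E.T₀ a b +
      ∑ τ ∈ Icc 1 t, if E.matching M τ ω a = some b then 1 else 0 := by
  induction t with
  | zero => simp [Environment.stats]
  | succ t ih =>
    rw [Finset.sum_Icc_succ_top (by omega), ← add_assoc, ← ih]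
    rfl

/-- The total is the sum of the rewards seen plus the sum of the initial samples. -/
theorem Environment.stats_total (E : Environment K P) (M : Mechanism N L) (ω : Ω) (t : ℕ)
    (a : Agent N L) (b : Partner a) :
    (E.stats M ω t).total a b = ∑ τ ∈ Icc 1 (initCount E.T₀ a b), E.X₀ τ a b ω +
      ∑ τ ∈ Icc 1 t, if E.matching M τ ω a = some b then E.X τ a b ω else 0 := by
  induction t with
  | zero => simp [Environment.stats]
  | succ t ih =>
    rw [Finset.sum_Icc_succ_top (by omega), ← add_assoc, ← ih]
    rfl

/-- The reward of `a` for the match `b` at time `t`, with reward zero if unmatched. -/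
def Environment.reward (E : Environment K P) (t : ℕ) (a : Agent N L) (b : Option (Partner a))
    (ω : Ω) : ℝ :=
  match b with
  | none => 0
  | some b => E.X t a b ω

/-- The observed payoff `U_t(a, b; ν_t)`. -/
def Environment.observed (E : Environment K P) (C R : Rule N L) (M : Mechanism N L) (t : ℕ)
    (a : Agent N L) (b : Option (Partner a)) (ω : Ω) : ℝ :=
  E.reward t a b ω - C (E.ν M t ω) a b + R (E.ν M t ω) a b

/-! ### Desiderata -/

/-- At all times up to `T`, the matching is stable under the transient payoffs. -/
def IncentiveCompatible (E : Environment K P) (C R : Rule N L) (M : Mechanism N L)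
    (T : ℕ) : Prop :=
  ∀ t ∈ Icc 1 T, ∀ ω, E.matching M t ω ∈ stableSet (payoff C R (E.ν M t ω))

/-- At all times up to `T`, the matching is one returned by the Gale–Shapley algorithm over the
transient payoffs. -/
def AppliesGS (E : Environment K P) (C R : Rule N L) (M : Mechanism N L) (T : ℕ) : Prop :=
  ∀ t ∈ Icc 1 T, ∀ ω, IsGSOutput (payoff C R (E.ν M t ω)) (E.matching M t ω)

/-- `m` maximizes the expected payoff of `a` at time `t` among the truly stable matchings. -/
def IsOptimalFor (E : Environment K P) (C R : Rule N L) (M : Mechanism N L) (t : ℕ)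
    (a : Agent N L) (m : Assignment N L) : Prop :=
  m ∈ stableSet (payoff C R K.μ) ∧ ∀ m' ∈ stableSet (payoff C R K.μ),
    ∫ ω, E.observed C R M t a (m' a) ω ∂P ≤ ∫ ω, E.observed C R M t a (m a) ω ∂P

/-- `m` minimizes the expected payoff of `a` at time `t` among the truly stable matchings. -/
def IsPessimalFor (E : Environment K P) (C R : Rule N L) (M : Mechanism N L) (t : ℕ)
    (a : Agent N L) (m : Assignment N L) : Prop :=
  m ∈ stableSet (payoff C R K.μ) ∧ ∀ m' ∈ stableSet (payoff C R K.μ),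
    ∫ ω, E.observed C R M t a (m a) ω ∂P ≤ ∫ ω, E.observed C R M t a (m' a) ω ∂P

/-- A choice of an optimal matching for `a` at time `t`. -/
def optimalMatching (E : Environment K P) (C R : Rule N L) (M : Mechanism N L) (t : ℕ)
    (a : Agent N L) : Assignment N L :=
  Classical.epsilon (IsOptimalFor E C R M t a)

/-- A choice of a pessimal matching for `a` at time `t`. -/
def pessimalMatching (E : Environment K P) (C R : Rule N L) (M : Mechanism N L) (t : ℕ)
    (a : Agent N L) : Assignment N L :=
  Classical.epsilon (IsPessimalFor E C R M t a)

/-- The optimal regret of `a` at horizon `T`. -/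
def optimalRegret (E : Environment K P) (C R : Rule N L) (M : Mechanism N L)
    (a : Agent N L) (T : ℕ) : ℝ :=
  ∫ ω, ∑ t ∈ Icc 1 T, (E.observed C R M t a (optimalMatching E C R M t a a) ω -
    E.observed C R M t a (E.matching M t ω a) ω) ∂P

/-- The pessimal regret of `a` at horizon `T`. -/
def pessimalRegret (E : Environment K P) (C R : Rule N L) (M : Mechanism N L)
    (a : Agent N L) (T : ℕ) : ℝ :=
  ∫ ω, ∑ t ∈ Icc 1 T, (E.observed C R M t a (pessimalMatching E C R M t a a) ω -
    E.observed C R M t a (E.matching M t ω a) ω) ∂P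

/-- `f = O(log T)`. -/
def IsBigOLog (f : ℕ → ℝ) : Prop := f =O[atTop] fun T : ℕ => Real.log T

/-- `f = ω(log T)`. -/
def IsLittleOmegaLog (f : ℕ → ℝ) : Prop := ∀ c : ℝ, ∀ᶠ T : ℕ in atTop, c * Real.log T ≤ f T

/-- `f = Ω(T)`. -/
def IsOmegaLinear (f : ℕ → ℝ) : Prop := ∃ c : ℝ, 0 < c ∧ ∀ᶠ T : ℕ in atTop, c * T ≤ f T

/-- Unfairness: for some proper nonempty set of agents, an agent in it has optimal regret
`O(log T)` while an agent outside it has optimal regret `ω(log T)`. -/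
def Unfair (E : Environment K P) (C R : Rule N L) (M : Mechanism N L) : Prop :=
  ∃ S : Finset (Agent N L), 0 < S.card ∧ S.card < Fintype.card (Agent N L) ∧
    ∃ a ∈ S, ∃ a' ∉ S,
      IsBigOLog (optimalRegret E C R M a) ∧ IsLittleOmegaLog (optimalRegret E C R M a')

/-- The sum of the payoffs of all agents under the matching `m`. -/
def welfare (V : Pref N L) (m : Assignment N L) : ℝ := ∑ a, V a (m a)

/-- The largest welfare over the feasible matchings. -/
def maxWelfare (V : Pref N L) : ℝ := sSup {w | ∃ m, Feasible m ∧ w = welfare V m}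

/-- The realized social welfare is at least half of the maximum at every time up to `T`. -/
def HighWelfare (E : Environment K P) (C R : Rule N L) (M : Mechanism N L) (T : ℕ)
    (ω : Ω) : Prop :=
  ∀ t ∈ Icc 1 T, 1 / 2 * maxWelfare (payoff C R (E.ν M t ω)) ≤
    welfare (payoff C R (E.ν M t ω)) (E.matching M t ω)

end

end MatchingBandits

open MatchingBandits

namespace MatchingBandits

/-! ### Gale–Shapley -/

/-! Gale–Shapley outputs are stable because `GSInvariant` survives every step: a provider has
already proposed to every user it prefers to its match, and that user holds an offer at least as
good. This gives incentive compatibility.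

The regret bounds all rest on the event `mistake`: some agent truly prefers an alternative to its
assigned match, but its reports do not. Outside this event a truly blocking pair also blocks under
the reports, so a matching stable for the reports is truly stable, and its value is at least the
pessimal one. The pessimal regret is thus at most `gapMax` times the expected number of mistakes. A
mistake on a match `b` forces either a failed confidence bound or a count of `b` so small that twice
the width reaches `gapMin` (`mistake_subset`). The second alternative is rare because each such
match adds a sample of `b` (`sum_measure_count_le`). The first has probability at most a constant
times `t ^ (1 - α)` for each ordered pair. As sampling is adaptive, this is proved with an
exponential supermartingale (`lintegral_exp_deviation_le`), Markov's inequality for each value of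
the count, and a union bound over these values. So mistakes are logarithmic in number
(`sum_measure_mistake_le`).

For the negative results, in `conflictMarket` user 2 and provider 2 are each other's favourites, so
every stable matching pairs them. The other four agents may be paired by the identity, best for
providers, or by the swap, best for users. Outside mistakes, Gale–Shapley returns the identity
(`conflictMarket_isGSOutput`): user 0 loses 1 per round, while user 2 is indifferent between the
stable matchings. Under incentive compatibility alone, user 0 or provider 0 loses 1 in each such
round, so their regrets have a linear sum. Finally, user 0 values provider 2 at 100, which no stable
matching collects; with deterministic rewards the reports at time 1 are the true preferences, and
welfare is already too low. -/

theorem pair_inl {N L : ℕ} (m : Assignment N L) (u u' : Fin N) (p : Fin L) :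
    pair m u p (Sum.inl u') = if u' = u then some p else m (Sum.inl u') := by
  unfold pair
  rw [Function.update_of_ne (by simp)]
  by_cases h : u' = u
  · subst h
    simp
  · rw [Function.update_of_ne (by simpa using h), if_neg h]

theorem pair_inr {N L : ℕ} (m : Assignment N L) (u : Fin N) (p p' : Fin L) :
    pair m u p (Sum.inr p') = if p' = p then some u else m (Sum.inr p') := by
  unfold pair
  by_cases h : p' = p
  · subst h
    simp
  · rw [Function.update_of_ne (by simpa using h), Function.update_of_ne (by simp), if_neg h]

theorem pair_unmatch_inl {N L : ℕ} (m : Assignment N L) (u u' : Fin N) (p p₁ : Fin L) :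
    pair (Function.update m (Sum.inr p₁) none) u p (Sum.inl u') =
      if u' = u then some p else m (Sum.inl u') := by
  rw [pair_inl]
  exact if_congr Iff.rfl rfl (Function.update_of_ne (by simp) _ _)

theorem pair_unmatch_inr {N L : ℕ} (m : Assignment N L) (u : Fin N) (p p₁ p' : Fin L) :
    pair (Function.update m (Sum.inr p₁) none) u p (Sum.inr p') =
      if p' = p then some u else if p' = p₁ then none else m (Sum.inr p') := by
  rw [pair_inr]
  refine if_congr Iff.rfl rfl ?_
  by_cases h : p' = p₁
  · subst h
    simp
  · rw [if_neg h]
    exact Function.update_of_ne (by simpa using h) _ _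

/-- The matching bookkeeping of a `swap` step, in which `u` leaves `p₁` for `p`, freed from the
dependent type `Assignment` so that a case split closes it. -/
theorem mutual_swap {U W : Type*} [DecidableEq U] [DecidableEq W] {x : U → Option W}
    {y : W → Option U} (h : ∀ u p, x u = some p ↔ y p = some u) {u : U} {p p₁ : W}
    (hp : y p = none) (hu : x u = some p₁) (u' : U) (p' : W) :
    (if u' = u then some p else x u') = some p' ↔
      (if p' = p then some u else if p' = p₁ then none else y p') = some u' := by
  have h1 := h u' p'
  have h2 := h u' p
  have h3 := h u' p₁
  have h4 := h u p₁
  have h5 := h u p'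
  split_ifs <;> grind

/-- The matches are mutual, the queues are sorted without repetition, nobody left in the queue of
a provider is better than its match, and a user who has received a proposal holds one at least as
good. -/
structure GSInvariant {N L : ℕ} (V : Pref N L) (s : GSState N L) : Prop where
  symm : ∀ (u : Fin N) (p : Fin L), s.1 (Sum.inl u) = some p ↔ s.1 (Sum.inr p) = some u
  nodup : ∀ p, (s.2 p).Nodup
  sorted : ∀ p, (s.2 p).Pairwise
    (fun u u' => V (Sum.inr p) (some u') ≤ V (Sum.inr p) (some u))
  notMem : ∀ (u : Fin N) (p : Fin L), s.1 (Sum.inr p) = some u → u ∉ s.2 p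
  match_le : ∀ (u : Fin N) (p : Fin L), s.1 (Sum.inr p) = some u →
    ∀ u' ∈ s.2 p, V (Sum.inr p) (some u') ≤ V (Sum.inr p) (some u)
  proposed : ∀ (u : Fin N) (p : Fin L), u ∉ s.2 p →
    ∃ p' : Fin L, s.1 (Sum.inl u) = some p' ∧ V (Sum.inl u) (some p) ≤ V (Sum.inl u) (some p')

theorem GSInvariant.init {N L : ℕ} {V : Pref N L} {Q : Fin L → List (Fin N)}
    (hQ : ∀ p, IsRanking V p (Q p)) : GSInvariant V (fun _ => none, Q) where
  symm := by simp
  nodup p := (hQ p).1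
  sorted p := (hQ p).2.2
  notMem := by simp
  match_le := by simp
  proposed u p h := absurd ((hQ p).2.1 u) h

/-- Only the proposer's queue changes, by losing its head. Sortedness makes that head at least as
good as the remaining users, which gives `match_le` for a new pair; a user gives up a match only for
a strictly better one, which keeps `proposed`. -/
theorem GSInvariant.step {N L : ℕ} {V : Pref N L} {s s' : GSState N L} (hs : GSInvariant V s)
    (h : GSStep V s s') : GSInvariant V s' := by
  have key : ∀ (m : Assignment N L) (Q : Fin L → List (Fin N)) (p : Fin L) (u : Fin N)
      (q : List (Fin N)), GSInvariant V (m, Q) → Q p = u :: q →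
      (∀ p', ((Function.update Q p q) p').Nodup) ∧
      (∀ p', ((Function.update Q p q) p').Pairwise
        (fun u u' => V (Sum.inr p') (some u') ≤ V (Sum.inr p') (some u))) ∧
      (∀ u' p', u' ∈ Function.update Q p q p' → u' ∈ Q p') ∧
      (∀ u' p', u' ∉ Function.update Q p q p' → u' ∉ Q p' ∨ (u' = u ∧ p' = p)) ∧
      (∀ u' ∈ q, V (Sum.inr p) (some u') ≤ V (Sum.inr p) (some u)) ∧ u ∉ q := by
    intro m Q p u q hI hQ
    have h1 := hI.nodup p
    have h2 := hI.sorted p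
    simp only [hQ] at h1 h2
    rw [List.nodup_cons] at h1
    rw [List.pairwise_cons] at h2
    refine ⟨fun p' => ?_, fun p' => ?_, fun u' p' => ?_, fun u' p' => ?_, h2.1, h1.1⟩
    · by_cases hp : p' = p
      · subst hp; simpa using h1.2
      · simpa [Function.update_of_ne hp] using hI.nodup p'
    · by_cases hp : p' = p
      · subst hp; simpa using h2.2
      · simpa [Function.update_of_ne hp] using hI.sorted p'
    · by_cases hp : p' = p
      · subst hp; simp [hQ]; exact Or.inr
      · simp [Function.update_of_ne hp]
    · by_cases hp : p' = p
      · subst hp; simp [hQ]; tauto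
      · simp only [Function.update_of_ne hp]; tauto
  cases h with
  | accept m Q p u q hp hQ hu =>
    obtain ⟨k1, k2, k3, k4, k5, k6⟩ := key m Q p u q hs hQ
    refine ⟨fun u' p' => ?_, k1, k2, fun u' p' h => ?_, fun u' p' h v hv => ?_,
      fun u' p' h => ?_⟩
    · have := hs.symm u' p'
      have h2 := hs.symm u p'
      have h3 := hs.symm u' p
      simp only [pair_inl, pair_inr] at this h2 h3 ⊢
      by_cases a1 : u' = u <;> by_cases a2 : p' = p <;> simp_all [eq_comm]
    · simp only [pair_inr] at h
      split_ifs at h with h1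
      · subst h1
        cases h
        simpa using k6
      · exact fun hv => hs.notMem u' p' h (k3 _ _ hv)
    · simp only [pair_inr] at h
      split_ifs at h with h1
      · subst h1
        cases h
        simp only [Function.update_self] at hv
        exact k5 v hv
      · exact hs.match_le u' p' h v (k3 _ _ hv)
    · simp only [pair_inl]
      split_ifs with h1
      · subst h1
        refine ⟨p, rfl, ?_⟩
        rcases k4 _ _ h with h2 | ⟨-, rfl⟩
        · obtain ⟨p'', h3, -⟩ := hs.proposed _ _ h2
          simp [hu] at h3
        · exact le_rfl
      · rcases k4 _ _ h with h2 | ⟨h2, -⟩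
        · exact hs.proposed _ _ h2
        · exact absurd h2 h1
  | swap m Q p p₁ u q hp hQ hu hV =>
    have e1 := fun u' => pair_unmatch_inl m u u' p p₁
    have e2 := fun p' => pair_unmatch_inr m u p p₁ p'
    generalize pair (Function.update m (Sum.inr p₁) none) u p = m' at e1 e2 ⊢
    obtain ⟨k1, k2, k3, k4, k5, k6⟩ := key m Q p u q hs hQ
    refine ⟨fun u' p' => ?_, k1, k2, fun u' p' h => ?_, fun u' p' h v hv => ?_,
      fun u' p' h => ?_⟩
    · simp only [e1, e2]
      exact mutual_swap hs.symm hp hu u' p'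
    · simp only [e2] at h
      split_ifs at h with h1 h1'
      · subst h1
        cases h
        simpa using k6
      · exact fun hv => hs.notMem u' p' h (k3 _ _ hv)
    · simp only [e2] at h
      split_ifs at h with h1 h1'
      · subst h1
        cases h
        simp only [Function.update_self] at hv
        exact k5 v hv
      · exact hs.match_le u' p' h v (k3 _ _ hv)
    · simp only [e1]
      split_ifs with h1
      · subst h1
        refine ⟨p, rfl, ?_⟩
        rcases k4 _ _ h with h2 | ⟨-, rfl⟩
        · obtain ⟨p'', h3, h4⟩ := hs.proposed _ _ h2
          simp only [hu, Option.some.injEq] at h3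
          subst h3
          exact h4.trans hV.le
        · exact le_rfl
      · rcases k4 _ _ h with h2 | ⟨h2, -⟩
        · exact hs.proposed _ _ h2
        · exact absurd h2 h1
  | reject m Q p p₁ u q hp hQ hu hV =>
    obtain ⟨k1, k2, k3, k4, k5, k6⟩ := key m Q p u q hs hQ
    refine ⟨hs.symm, k1, k2, fun u' p' h hv => hs.notMem u' p' h (k3 _ _ hv),
      fun u' p' h v hv => hs.match_le u' p' h v (k3 _ _ hv),
      fun u' p' h => ?_⟩
    rcases k4 _ _ h with h2 | ⟨rfl, rfl⟩
    · exact hs.proposed _ _ h2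
    · exact ⟨p₁, hu, hV⟩

theorem GSInvariant.run {N L : ℕ} {V : Pref N L} {s s' : GSState N L} (hs : GSInvariant V s)
    (h : Relation.ReflTransGen (GSStep V) s s') : GSInvariant V s' := by
  induction h with
  | refl => exact hs
  | tail _ h ih => exact ih.step h

/-- The Gale–Shapley algorithm returns stable matchings. -/
theorem IsGSOutput.mem_stableSet {N L : ℕ} {V : Pref N L} {m : Assignment N L}
    (h : IsGSOutput V m) : m ∈ stableSet V := by
  obtain ⟨Q₀, Q, hQ₀, hrun, hm⟩ := h
  have I := (GSInvariant.init hQ₀).run hrun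
  refine ⟨⟨I.symm, hm⟩, fun u p ⟨h1, h2⟩ => ?_⟩
  obtain ⟨u', hu'⟩ := Option.ne_none_iff_exists'.1 (hm p)
  -- A user strictly better than the match of `p` cannot remain in the queue, so `p` has proposed to
  -- `u`, who therefore holds an offer at least as good as `p`.
  have h3 : u ∉ Q p := fun h3 => by
    have := I.match_le u' p hu' u h3
    rw [hu'] at h2
    exact absurd h2 (not_lt.2 this)
  obtain ⟨p', h4, h5⟩ := I.proposed u p h3
  simp only at h4
  rw [h4] at h1
  exact absurd h1 (not_lt.2 h5)

/-! ### Termination of the Gale–Shapley algorithm -/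

theorem GSStep.sum_length {N L : ℕ} {V : Pref N L} {s s' : GSState N L} (h : GSStep V s s') :
    ∑ p, (s'.2 p).length < ∑ p, (s.2 p).length := by
  have key : ∀ (Q : Fin L → List (Fin N)) (p : Fin L) (u : Fin N) (q : List (Fin N)),
      Q p = u :: q → ∑ p', (Function.update Q p q p').length < ∑ p', (Q p').length := by
    intro Q p u q hQ
    refine Finset.sum_lt_sum (fun p' _ => ?_) ⟨p, Finset.mem_univ _, ?_⟩
    · by_cases hp : p' = p
      · subst hp; simp [hQ]
      · simp [Function.update_of_ne hp]
    · simp [hQ]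
  cases h with
  | accept m Q p u q hp hQ hu => exact key Q p u q hQ
  | swap m Q p p₁ u q hp hQ hu hV => exact key Q p u q hQ
  | reject m Q p p₁ u q hp hQ hu hV => exact key Q p u q hQ

theorem GSStep.queue_subset {N L : ℕ} {V : Pref N L} {s s' : GSState N L} (h : GSStep V s s')
    (p : Fin L) : s'.2 p ⊆ s.2 p := by
  have key : ∀ (Q : Fin L → List (Fin N)) (p₀ : Fin L) (u : Fin N) (q : List (Fin N)),
      Q p₀ = u :: q → Function.update Q p₀ q p ⊆ Q p := by
    intro Q p₀ u q hQ
    by_cases hp : p = p₀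
    · subst hp; simp [hQ]
    · simp [Function.update_of_ne hp]
  cases h with
  | accept m Q p u q hp hQ hu => exact key Q p u q hQ
  | swap m Q p p₁ u q hp hQ hu hV => exact key Q p u q hQ
  | reject m Q p p₁ u q hp hQ hu hV => exact key Q p u q hQ

/-- The algorithm is never stuck: if an unmatched `p` had exhausted its queue, every user would be
matched, injecting `N` users into the `L - 1` other providers. -/
theorem GSInvariant.exists_step {N L : ℕ} (hLN : L ≤ N) {V : Pref N L} {s : GSState N L}
    (hs : GSInvariant V s) {p : Fin L} (hp : s.1 (Sum.inr p) = none) :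
    ∃ s', GSStep V s s' := by
  obtain ⟨m, Q⟩ := s
  simp only at hp
  rcases hQ : Q p with _ | ⟨u, q⟩
  · exfalso
    have h1 : ∀ u : Fin N, ∃ p' : Fin L, m (Sum.inl u) = some p' := fun u => by
      obtain ⟨p', h, -⟩ := hs.proposed u p (by simp [hQ])
      exact ⟨p', h⟩
    choose f hf using h1
    have hinj : Function.Injective f := fun u u' h => by
      have h2 := (hs.symm _ _).1 (hf u)
      have h3 := (hs.symm _ _).1 (hf u')
      rw [h] at h2
      exact Option.some.inj (h2.symm.trans h3)
    have hne : ∀ u, f u ≠ p := fun u h => by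
      have h2 := (hs.symm _ _).1 (hf u)
      rw [h] at h2
      exact absurd (hp.symm.trans h2) (by simp)
    have hcard := Finset.card_le_card_of_injOn (s := Finset.univ) (t := Finset.univ.erase p) f
      (fun u _ => by simpa using hne u) hinj.injOn
    rw [Finset.card_erase_of_mem (Finset.mem_univ _)] at hcard
    simp only [Finset.card_univ, Fintype.card_fin] at hcard
    have := p.pos
    omega
  · rcases hu : m (Sum.inl u) with _ | p'
    · exact ⟨_, GSStep.accept m Q p u q hp hQ hu⟩
    · rcases lt_or_ge (V (Sum.inl u) (some p')) (V (Sum.inl u) (some p)) with h | h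
      · exact ⟨_, GSStep.swap m Q p p' u q hp hQ hu h⟩
      · exact ⟨_, GSStep.reject m Q p p' u q hp hQ hu h⟩

theorem exists_isRanking {N L : ℕ} (V : Pref N L) (p : Fin L) : ∃ l, IsRanking V p l := by
  classical
  let r : Fin N → Fin N → Prop := fun u u' => V (Sum.inr p) (some u') ≤ V (Sum.inr p) (some u)
  have hsort : ((Finset.univ : Finset (Fin N)).toList.insertionSort r).Perm
      (Finset.univ : Finset (Fin N)).toList := List.perm_insertionSort r _
  have : Std.Total r := ⟨fun a b => le_total _ _⟩
  have : IsTrans (Fin N) r := ⟨fun a b c h h' => le_trans h' h⟩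
  refine ⟨_, hsort.nodup_iff.2 (Finset.nodup_toList _), fun u => hsort.mem_iff.2 (by simp), ?_⟩
  exact List.pairwise_insertionSort r _

/-- The Gale–Shapley algorithm terminates. -/
theorem exists_isGSOutput {N L : ℕ} (hLN : L ≤ N) (V : Pref N L) : ∃ m, IsGSOutput V m := by
  choose Q₀ hQ₀ using exists_isRanking V
  have key : ∀ (n : ℕ) (s : GSState N L), ∑ p, (s.2 p).length = n → GSInvariant V s →
      ∃ s', Relation.ReflTransGen (GSStep V) s s' ∧ ∀ p, s'.1 (Sum.inr p) ≠ none := by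
    intro n
    induction n using Nat.strong_induction_on with
    | _ n ih =>
      intro s hn hs
      by_cases h : ∀ p, s.1 (Sum.inr p) ≠ none
      · exact ⟨s, .refl, h⟩
      · push Not at h
        obtain ⟨p, hp⟩ := h
        obtain ⟨s₁, h₁⟩ := hs.exists_step hLN hp
        obtain ⟨s', h', h''⟩ := ih _ (hn ▸ h₁.sum_length) s₁ rfl (hs.step h₁)
        exact ⟨s', .head h₁ h', h''⟩
  obtain ⟨⟨m, Q⟩, h, h'⟩ := key _ _ rfl (GSInvariant.init hQ₀)
  exact ⟨m, Q₀, Q, hQ₀, h, h'⟩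

theorem stableSet_nonempty {N L : ℕ} (hLN : L ≤ N) (V : Pref N L) : (stableSet V).Nonempty :=
  let ⟨m, hm⟩ := exists_isGSOutput hLN V
  ⟨m, hm.mem_stableSet⟩

/-! ### Gale–Shapley as a measurable mechanism -/

theorem GSStep.congr {N L : ℕ} {V V' : Pref N L}
    (hV : ∀ a b c, V a b ≤ V a c ↔ V' a b ≤ V' a c) {s s' : GSState N L} (h : GSStep V s s') :
    GSStep V' s s' := by
  have hlt : ∀ a b c, V a b < V a c ↔ V' a b < V' a c := fun a b c => by
    rw [← not_le, ← not_le, hV]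
  cases h with
  | accept m Q p u q hp hQ hu => exact .accept m Q p u q hp hQ hu
  | swap m Q p p₁ u q hp hQ hu h => exact .swap m Q p p₁ u q hp hQ hu ((hlt _ _ _).1 h)
  | reject m Q p p₁ u q hp hQ hu h => exact .reject m Q p p₁ u q hp hQ hu ((hV _ _ _).1 h)

/-- The algorithm reads payoffs only through comparisons, so an output can be chosen once for each
ordinal pattern. -/
theorem IsGSOutput.congr {N L : ℕ} {V V' : Pref N L}
    (hV : ∀ a b c, V a b ≤ V a c ↔ V' a b ≤ V' a c) {m : Assignment N L} (h : IsGSOutput V m) :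
    IsGSOutput V' m := by
  obtain ⟨Q₀, Q, h1, h2, h3⟩ := h
  refine ⟨Q₀, Q, fun p => ⟨(h1 p).1, (h1 p).2.1, (h1 p).2.2.imp fun h => (hV _ _ _).1 h⟩,
    Relation.ReflTransGen.mono (fun _ _ h => GSStep.congr hV h) _ _ h2, h3⟩

/-- Some measurable mechanism applies the Gale–Shapley algorithm to every profile. -/
theorem exists_mechanism_isGSOutput {N L : ℕ} (hLN : L ≤ N) :
    ∃ M : Mechanism N L, ∀ ψ, IsGSOutput ψ (M.toFun ψ) := by
  classical
  -- There are finitely many comparison patterns, so measurability of the mechanism reduces to that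
  -- of the comparisons `ψ a b ≤ ψ a c`. Patterns that no profile realizes get a junk value.
  let Pattern := ((a : Agent N L) → Option (Partner a) → Option (Partner a) → Prop)
  let pat : Pref N L → Pattern := fun ψ a b c => ψ a b ≤ ψ a c
  have : Finite Pattern := inferInstance
  let f : Pattern → Assignment N L := fun π =>
    if h : ∃ ψ, pat ψ = π then (exists_isGSOutput hLN h.choose).choose else fun _ => none
  have hmeas : Measurable pat := by
    refine measurable_pi_lambda _ fun a => measurable_pi_lambda _ fun b =>
      measurable_pi_lambda _ fun c => ?_
    refine measurableSet_setOfPred.1 ?_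
    exact measurableSet_le (by fun_prop) (by fun_prop)
  refine ⟨⟨fun ψ => f (pat ψ), fun m => ?_⟩, fun ψ => ?_⟩
  · exact hmeas (t := {π | f π = m}) (Set.toFinite _).measurableSet
  · have h : ∃ ψ', pat ψ' = pat ψ := ⟨ψ, rfl⟩
    change IsGSOutput ψ (f (pat ψ))
    simp only [f, dif_pos h]
    refine (exists_isGSOutput hLN h.choose).choose_spec.congr fun a b c => ?_
    exact iff_of_eq (congrFun (congrFun (congrFun h.choose_spec a) b) c)

/-- Let `f` assign a target to each provider in `A`. If every provider that proposes to the target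
of another one in `A` is in `A` and prefers its own target, then no provider in `A` is turned down
by its target. -/
theorem mem_queue_or_match_of_run {N L : ℕ} {V : Pref N L} {A : Set (Fin L)} {f : Fin L → Fin N}
    {s s' : GSState N L} (hs : GSInvariant V s) (hall : ∀ p u, u ∈ s.2 p)
    (h : Relation.ReflTransGen (GSStep V) s s')
    (hf : ∀ p ∈ A, ∀ p', p ≠ p' → f p ∈ s'.2 p' ∨
      p' ∈ A ∧ V (Sum.inr p') (some (f p)) < V (Sum.inr p') (some (f p'))) (p : Fin L)
    (hpA : p ∈ A) :
    f p ∈ s'.2 p ∨ s'.1 (Sum.inr p) = some (f p) := by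
  induction h generalizing p with
  | refl => exact Or.inl (hall _ _)
  | @tail s₁ s₂ hrun hstep ih =>
    have I := hs.run hrun
    have I' := I.step hstep
    -- The hypothesis concerns the final queues; queues only shrink, so it passes to the earlier
    -- state.
    replace ih := ih fun p hpA p' hp => (hf p hpA p' hp).imp_left fun h => hstep.queue_subset p' h
    by_cases hin : f p ∈ s₂.2 p
    · exact Or.inl hin
    right
    have pop : ∀ (Q : Fin L → List (Fin N)) (p₀ : Fin L) (u : Fin N) (q : List (Fin N)),
        Q p₀ = u :: q → f p ∈ Q p → f p ∉ Function.update Q p₀ q p → p₀ = p ∧ u = f p := by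
      intro Q p₀ u q hQ h1 h2
      by_cases hp : p = p₀
      · subst hp
        simp only [Function.update_self] at h2
        simp only [hQ, List.mem_cons] at h1
        exact ⟨rfl, (h1.resolve_right h2).symm⟩
      · rw [Function.update_of_ne hp] at h2
        exact absurd h1 h2
    -- A rival holding `f p` has proposed to it, hence belongs to `A` and prefers its own target. By
    -- induction that target is still in its queue, against `match_le`, or is its match, against
    -- strictness.
    have notheld : ∀ p' : Fin L, p ≠ p' → s₁.1 (Sum.inr p') = some (f p) → False := by
      intro p' hp' hm
      have hq : f p ∉ s₂.2 p' := fun h => I.notMem _ _ hm (hstep.queue_subset p' h)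
      rcases hf p hpA p' hp' with h | ⟨hA, h⟩
      · exact hq h
      · rcases ih p' hA with h' | h'
        · exact absurd h (not_lt.2 (I.match_le _ _ hm _ h'))
        · rw [hm] at h'
          exact absurd h (by rw [Option.some.inj h']; exact lt_irrefl _)
    cases hstep with
    | accept m Q p₀ u q hp hQ hu =>
      simp only [pair_inr]
      rcases ih p hpA with h1 | h1
      · obtain ⟨rfl, rfl⟩ := pop Q p₀ u q hQ h1 hin
        simp
      · rw [if_neg (by rintro rfl; simp [hp] at h1)]
        exact h1
    | swap m Q p₀ p₁ u q hp hQ hu hV =>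
      have e2 := fun p' => pair_unmatch_inr m u p₀ p₁ p'
      generalize pair (Function.update m (Sum.inr p₁) none) u p₀ = m' at e2 hf hin I' ⊢
      simp only [e2]
      rcases ih p hpA with h1 | h1
      · obtain ⟨rfl, rfl⟩ := pop Q p₀ u q hQ h1 hin
        simp
      · have hne : p ≠ p₀ := by rintro rfl; simp [hp] at h1
        rw [if_neg hne, if_neg]
        · exact h1
        · rintro rfl
          have h2 : some u = some (f p) := ((I.symm u p).1 hu).symm.trans h1
          cases h2
          have hnd := I.nodup p₀
          have hso := I.sorted p₀
          simp only [hQ] at hnd hso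
          rw [List.nodup_cons] at hnd
          rw [List.pairwise_cons] at hso
          -- Here `p₀` displaces `p` at `f p`. It must prefer its own target, which by induction is
          -- still queued because `p₀` is unmatched; but the sorted queue has `f p` at its head.
          rcases hf p hpA p₀ hne with h3 | ⟨hA, h3⟩
          · simp only [Function.update_self] at h3
            exact hnd.1 h3
          · rcases ih p₀ hA with h4 | h4
            · simp only [hQ, List.mem_cons] at h4
              rcases h4 with h4 | h4
              · rw [h4] at h3
                exact lt_irrefl _ h3
              · exact absurd h3 (not_lt.2 (hso.1 _ h4))
            · simp [hp] at h4
    | reject m Q p₀ p₁ u q hp hQ hu hV =>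
      rcases ih p hpA with h1 | h1
      · obtain ⟨rfl, rfl⟩ := pop Q p₀ u q hQ h1 hin
        refine (notheld p₁ ?_ ((I.symm _ _).1 hu)).elim
        rintro rfl
        have := (I.symm _ _).1 hu
        simp [hp] at this
      · exact h1

/-! ### Measurability with respect to the past -/

section Rewards

variable {N L : ℕ} {K : Market N L} {Ω : Type*} [mΩ : MeasurableSpace Ω] {P : Measure Ω}

/-- All initial samples and rewards as one family. -/
def Environment.sample (E : Environment K P)
    (i : (ℕ ⊕ ℕ) × (Σ a : Agent N L, Partner a)) : Ω → ℝ :=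
  Sum.elim E.X₀ E.X i.1 i.2.1 i.2.2

/-- The information contained in the initial samples and in the rewards up to time `t`. -/
@[reducible]
def Environment.history (E : Environment K P) (t : ℕ) : MeasurableSpace Ω :=
  ⨆ i ∈ {i : (ℕ ⊕ ℕ) × (Σ a : Agent N L, Partner a) | ∀ τ, i.1 = Sum.inr τ → τ ≤ t},
    MeasurableSpace.comap (E.sample i) inferInstance

theorem Environment.measurable_sample (E : Environment K P)
    (i : (ℕ ⊕ ℕ) × (Σ a : Agent N L, Partner a)) : Measurable (E.sample i) := by
  obtain ⟨τ | τ, a, b⟩ := i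
  · exact E.measurable_X₀ τ a b
  · exact E.measurable_X τ a b

theorem Environment.history_le (E : Environment K P) (t : ℕ) : E.history t ≤ mΩ :=
  iSup₂_le fun i _ => (E.measurable_sample i).comap_le

theorem Environment.history_mono (E : Environment K P) : Monotone E.history :=
  fun _ _ hst => biSup_mono fun _ hi τ hτ => (hi τ hτ).trans hst

theorem Environment.measurable_X₀_history (E : Environment K P) (t τ : ℕ) (a : Agent N L)
    (b : Partner a) : Measurable[E.history t] (E.X₀ τ a b) :=
  Measurable.of_comap_le (le_iSup₂_of_le (Sum.inl τ, ⟨a, b⟩) (by simp) le_rfl)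

theorem Environment.measurable_X_history (E : Environment K P) {t τ : ℕ} (h : τ ≤ t)
    (a : Agent N L) (b : Partner a) : Measurable[E.history t] (E.X τ a b) :=
  Measurable.of_comap_le (le_iSup₂_of_le (Sum.inr τ, ⟨a, b⟩) (by simpa using h) le_rfl)

/-- The index of a reward at time `t + 1` lies outside the set of indices generating `history t`,
and disjoint blocks of an independent family are independent. -/
theorem Environment.indep_history (E : Environment K P) (t : ℕ) (a : Agent N L)
    (b : Partner a) :
    Indep (E.history t) (MeasurableSpace.comap (E.X (t + 1) a b) inferInstance) P := by
  have h := indep_iSup_of_disjoint (S := {i | ∀ τ, i.1 = Sum.inr τ → τ ≤ t})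
    (T := {(Sum.inr (t + 1), ⟨a, b⟩)}) (fun i => (E.measurable_sample i).comap_le)
    ((iIndepFun_iff_iIndep _ _ _).1 E.indep) (by simp)
  simp only [Set.mem_singleton_iff, iSup_iSup_eq_left] at h
  exact h

theorem measurable_ucb (E : Environment K P) (t : ℕ) {Ω' : Type*} {m : MeasurableSpace Ω'}
    {s : Ω' → Stats N L} (hc : ∀ a b, Measurable[m] fun ω => (s ω).count a b)
    (ht : ∀ a b, Measurable[m] fun ω => (s ω).total a b) :
    Measurable[m] fun ω => E.ucb t (s ω) := by
  refine measurable_pi_lambda _ fun a => measurable_pi_lambda _ fun b => ?_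
  rcases b with _ | b
  · exact measurable_const
  · have hc' : Measurable[m] fun ω => ((s ω).count a b : ℝ) :=
      (measurable_from_top (f := fun n : ℕ => (n : ℝ))).comp (hc a b)
    exact ((ht a b).div hc').add (measurable_const.div hc').sqrt

theorem measurable_stats (E : Environment K P) (M : Mechanism N L) (t : ℕ) :
    (∀ a b, Measurable[E.history t] fun ω => (E.stats M ω t).count a b) ∧
      ∀ a b, Measurable[E.history t] fun ω => (E.stats M ω t).total a b := by
  induction t with
  | zero =>
    refine ⟨fun a b => measurable_const, fun a b => ?_⟩
    change Measurable[E.history 0] fun ω => ∑ τ ∈ Icc 1 (initCount E.T₀ a b), E.X₀ τ a b ω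
    exact Finset.measurable_fun_sum _ fun τ _ => E.measurable_X₀_history 0 τ a b
  | succ t ih =>
    have hle := E.history_mono t.le_succ
    have hν : Measurable[E.history (t + 1)] fun ω => E.ucb (t + 1) (E.stats M ω t) :=
      (measurable_ucb E (t + 1) ih.1 ih.2).mono hle le_rfl
    have hm : ∀ a b, MeasurableSet[E.history (t + 1)]
        {ω | M.toFun (E.ucb (t + 1) (E.stats M ω t)) a = some b} := by
      intro a b
      have h := hν (MeasurableSet.biUnion
        (Set.to_countable {m : Assignment N L | m a = some b}) fun m _ => M.measurable m)
      convert h using 1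
      ext ω
      simp
    refine ⟨fun a b => ?_, fun a b => ?_⟩
    · exact ((ih.1 a b).mono hle le_rfl).add
        (Measurable.ite (hm a b) measurable_const measurable_const)
    · exact ((ih.2 a b).mono hle le_rfl).add
        (Measurable.ite (hm a b) (E.measurable_X_history le_rfl a b) measurable_const)

theorem measurable_ν (E : Environment K P) (M : Mechanism N L) (t : ℕ) :
    Measurable[E.history (t - 1)] (E.ν M t) :=
  measurable_ucb E t (measurable_stats E M (t - 1)).1 (measurable_stats E M (t - 1)).2

/-- Predictability: the match at time `t` is decided by samples from before `t`, whence its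
independence from the rewards of time `t`. -/
theorem measurableSet_matching (E : Environment K P) (M : Mechanism N L) (t : ℕ)
    (S : Set (Assignment N L)) :
    MeasurableSet[E.history (t - 1)] {ω | E.matching M t ω ∈ S} := by
  have h := measurable_ν E M t (MeasurableSet.biUnion S.to_countable
    fun m _ => M.measurable m)
  convert h using 1
  ext ω
  simp [Environment.matching]

/-! ### The exponential supermartingale -/

/-- The factor that one new sample contributes to the exponential supermartingale. Working with
`lintegral` avoids integrability conditions on the adaptive products built from it. -/
theorem lintegral_exp_reward_le [IsProbabilityMeasure P] (E : Environment K P) (t : ℕ)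
    (a : Agent N L) (b : Partner a) (r : ℝ) :
    ∫⁻ ω, ENNReal.ofReal (Real.exp (r * (E.X t a b ω - K.μ a (some b)) -
      r ^ 2 * (E.σ : ℝ) ^ 2 / 2)) ∂P ≤ 1 := by
  have h : HasSubgaussianMGF (fun ω => E.X t a b ω - K.μ a (some b)) (E.σ ^ 2) P :=
    HasSubgaussianMGF.of_map (X := fun x : ℝ => x - K.μ a (some b))
      (E.measurable_X t a b).aemeasurable (by rw [E.law_X]; exact E.subgaussian_D a b)
  have hint : Integrable (fun ω => Real.exp (r * (E.X t a b ω - K.μ a (some b)) -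
      r ^ 2 * (E.σ : ℝ) ^ 2 / 2)) P := by
    simp_rw [Real.exp_sub]
    exact (h.integrable_exp_mul r).div_const _
  rw [← ofReal_integral_eq_lintegral_ofReal hint (ae_of_all _ fun _ => (Real.exp_pos _).le)]
  refine ENNReal.ofReal_le_one.2 ?_
  simp_rw [Real.exp_sub (r * _)]
  rw [integral_div, div_le_one (Real.exp_pos _)]
  refine (h.mgf_le r).trans_eq ?_
  push_cast
  ring_nf

theorem lintegral_exp_init_le [IsProbabilityMeasure P] (E : Environment K P)
    (a : Agent N L) (b : Partner a) (n : ℕ) (r : ℝ) :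
    ∫⁻ ω, ENNReal.ofReal (Real.exp (r * (∑ τ ∈ Icc 1 n, E.X₀ τ a b ω - K.μ a (some b) * n) -
      r ^ 2 * (E.σ : ℝ) ^ 2 / 2 * n)) ∂P ≤ 1 := by
  have h1 : ∀ τ, HasSubgaussianMGF (fun ω => E.X₀ τ a b ω - K.μ a (some b)) (E.σ ^ 2) P :=
    fun τ => HasSubgaussianMGF.of_map (X := fun x : ℝ => x - K.μ a (some b))
      (E.measurable_X₀ τ a b).aemeasurable (by rw [E.law_X₀]; exact E.subgaussian_D a b)
  have hind : iIndepFun (fun τ ω => E.X₀ τ a b ω - K.μ a (some b)) P := by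
    have h2 := E.indep.precomp (g := fun τ : ℕ =>
      ((Sum.inl τ, ⟨a, b⟩) : (ℕ ⊕ ℕ) × (Σ a : Agent N L, Partner a)))
      (fun τ τ' h => by simpa using h)
    exact h2.comp (fun _ x => x - K.μ a (some b)) fun _ => by fun_prop
  have h := HasSubgaussianMGF.sum_of_iIndepFun hind (s := Icc 1 n) fun τ _ => h1 τ
  simp only [Finset.sum_sub_distrib, Finset.sum_const, Nat.card_Icc, Nat.add_sub_cancel,
    nsmul_eq_mul] at h
  simp_rw [mul_comm (K.μ a (some b)) (n : ℝ)]
  have hint : Integrable (fun ω => Real.exp (r * (∑ τ ∈ Icc 1 n, E.X₀ τ a b ω -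
      n * K.μ a (some b)) - r ^ 2 * (E.σ : ℝ) ^ 2 / 2 * n)) P := by
    simp_rw [Real.exp_sub]
    exact (h.integrable_exp_mul r).div_const _
  rw [← ofReal_integral_eq_lintegral_ofReal hint (ae_of_all _ fun _ => (Real.exp_pos _).le)]
  refine ENNReal.ofReal_le_one.2 ?_
  simp_rw [Real.exp_sub (r * _)]
  rw [integral_div, div_le_one (Real.exp_pos _)]
  refine (h.mgf_le r).trans_eq ?_
  push_cast
  ring_nf

/-- The deviation of the total of the samples from its conditional mean. -/
noncomputable def deviation (E : Environment K P) (M : Mechanism N L) (t : ℕ) (a : Agent N L) (b : Partner a)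
    (ω : Ω) : ℝ :=
  (E.stats M ω t).total a b - K.μ a (some b) * (E.stats M ω t).count a b

/-- The process is multiplied by the one-sample factor when the pair is matched and unchanged
otherwise. Whether it is matched is known at time `t`, while the factor is independent of `history
t` with integral at most 1, so the expectation does not increase. -/
theorem lintegral_exp_deviation_le [IsProbabilityMeasure P] (E : Environment K P)
    (M : Mechanism N L) (a : Agent N L) (b : Partner a) (r : ℝ) (t : ℕ) :
    ∫⁻ ω, ENNReal.ofReal (Real.exp (r * deviation E M t a b ω -
      r ^ 2 * (E.σ : ℝ) ^ 2 / 2 * (E.stats M ω t).count a b)) ∂P ≤ 1 := by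
  induction t with
  | zero => exact lintegral_exp_init_le E a b (initCount E.T₀ a b) r
  | succ t ih =>
    refine le_trans ?_ ih
    set f : Ω → ENNReal := fun ω => ENNReal.ofReal (Real.exp (r * deviation E M t a b ω -
      r ^ 2 * (E.σ : ℝ) ^ 2 / 2 * (E.stats M ω t).count a b)) with hf
    set g : Ω → ENNReal := fun ω => ENNReal.ofReal (Real.exp (r * (E.X (t + 1) a b ω -
      K.μ a (some b)) - r ^ 2 * (E.σ : ℝ) ^ 2 / 2)) with hg
    set A : Set Ω := {ω | E.matching M (t + 1) ω a = some b} with hA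
    have hAm : MeasurableSet[E.history t] A :=
      measurableSet_matching E M (t + 1) {m | m a = some b}
    have hcount : Measurable[E.history t] fun ω => ((E.stats M ω t).count a b : ℝ) :=
      (measurable_from_top (f := fun n : ℕ => (n : ℝ))).comp ((measurable_stats E M t).1 a b)
    have hfm : Measurable[E.history t] f := by
      refine ENNReal.measurable_ofReal.comp (Real.measurable_exp.comp ?_)
      exact ((((measurable_stats E M t).2 a b).sub (hcount.const_mul _)).const_mul _).sub
        (hcount.const_mul _)
    have hle := E.history_le t
    have hgm : Measurable[MeasurableSpace.comap (E.X (t + 1) a b) inferInstance] g := by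
      have : Measurable fun x : ℝ => ENNReal.ofReal (Real.exp (r * (x -
        K.μ a (some b)) - r ^ 2 * (E.σ : ℝ) ^ 2 / 2)) := by fun_prop
      exact this.comp (comap_measurable _)
    have hsplit : ∀ ω, ENNReal.ofReal (Real.exp (r * deviation E M (t + 1) a b ω -
        r ^ 2 * (E.σ : ℝ) ^ 2 / 2 * (E.stats M ω (t + 1)).count a b)) =
        Aᶜ.indicator f ω + A.indicator f ω * g ω := by
      intro ω
      have hc : (E.stats M ω (t + 1)).count a b = (E.stats M ω t).count a b +
        if E.matching M (t + 1) ω a = some b then 1 else 0 := rfl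
      have ht : (E.stats M ω (t + 1)).total a b = (E.stats M ω t).total a b +
        if E.matching M (t + 1) ω a = some b then E.X (t + 1) a b ω else 0 := rfl
      by_cases h : E.matching M (t + 1) ω a = some b
      · have hmem : ω ∈ A := h
        rw [Set.indicator_of_notMem (by simpa using hmem), Set.indicator_of_mem hmem, zero_add,
          hf, hg, ← ENNReal.ofReal_mul (Real.exp_pos _).le, ← Real.exp_add]
        simp only [deviation, hc, ht, if_pos h]
        push_cast
        ring_nf
      · have hmem : ω ∉ A := h
        rw [Set.indicator_of_mem (by simpa using hmem), Set.indicator_of_notMem hmem, zero_mul,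
          add_zero, hf]
        simp only [deviation, hc, ht, if_neg h, add_zero]
    simp_rw [hsplit]
    rw [lintegral_add_left ((hfm.indicator hAm.compl).mono hle le_rfl),
      lintegral_mul_eq_lintegral_mul_lintegral_of_independent_measurableSpace hle
        (E.measurable_X (t + 1) a b).comap_le (E.indep_history t a b) (hfm.indicator hAm) hgm]
    calc _ ≤ ∫⁻ ω, Aᶜ.indicator f ω ∂P + (∫⁻ ω, A.indicator f ω ∂P) * 1 := by
          gcongr
          exact lintegral_exp_reward_le E (t + 1) a b r
      _ = ∫⁻ ω, f ω ∂P := by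
          rw [mul_one, add_comm, lintegral_indicator (hle _ hAm),
            lintegral_indicator (hle _ hAm).compl, lintegral_add_compl _ (hle _ hAm)]

/-- Markov's inequality for the supermartingale: fixing the count at `n` makes the compensating term
deterministic. -/
theorem measure_deviation_le [IsProbabilityMeasure P] (E : Environment K P)
    (M : Mechanism N L) (a : Agent N L) (b : Partner a) (r y : ℝ) (t n : ℕ) :
    P {ω | (E.stats M ω t).count a b = n ∧ y ≤ r * deviation E M t a b ω} ≤
      ENNReal.ofReal (Real.exp (r ^ 2 * (E.σ : ℝ) ^ 2 / 2 * n - y)) := by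
  have hdev : Measurable (deviation E M t a b) := by
    have hcount : Measurable fun ω => ((E.stats M ω t).count a b : ℝ) :=
      (measurable_from_top (f := fun n : ℕ => (n : ℝ))).comp
        (((measurable_stats E M t).1 a b).mono (E.history_le t) le_rfl)
    exact (((measurable_stats E M t).2 a b).mono (E.history_le t) le_rfl).sub
      (hcount.const_mul _)
  have hcount : Measurable fun ω => ((E.stats M ω t).count a b : ℝ) :=
    (measurable_from_top (f := fun n : ℕ => (n : ℝ))).comp
      (((measurable_stats E M t).1 a b).mono (E.history_le t) le_rfl)
  set c := r ^ 2 * (E.σ : ℝ) ^ 2 / 2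
  have h := mul_meas_ge_le_lintegral (μ := P) (f := fun ω => ENNReal.ofReal (Real.exp
    (r * deviation E M t a b ω - c * (E.stats M ω t).count a b))) (by fun_prop)
    (ENNReal.ofReal (Real.exp (y - c * n)))
  have h2 := h.trans (lintegral_exp_deviation_le E M a b r t)
  have h3 : P {ω | (E.stats M ω t).count a b = n ∧ y ≤ r * deviation E M t a b ω} ≤
      P {ω | ENNReal.ofReal (Real.exp (y - c * n)) ≤ ENNReal.ofReal (Real.exp
        (r * deviation E M t a b ω - c * (E.stats M ω t).count a b))} := by
    refine measure_mono fun ω ⟨h1, h2⟩ => ?_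
    simp only [Set.mem_ofPred_eq, h1]
    exact ENNReal.ofReal_le_ofReal (Real.exp_le_exp.2 (by linarith))
  refine h3.trans ?_
  rw [show c * n - y = -(y - c * n) by ring, Real.exp_neg, ENNReal.ofReal_inv_of_pos
    (Real.exp_pos _)]
  rw [mul_comm] at h2
  exact (ENNReal.le_inv_iff_mul_le).2 h2

end Rewards

/-! ### Failures of the confidence bounds -/

/-- Comparison with the integral of `x ^ (1 - α)`: the term `t = 1` gives 1 and the tail telescopes
to at most `1 / (α - 2)`, for a total of `(α - 1) / (α - 2)`. -/
theorem sum_rpow_le {α : ℝ} (hα : 2 < α) (T : ℕ) :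
    ∑ t ∈ Icc 1 T, (t : ℝ) ^ (1 - α) ≤ α / (α - 2) := by
  have hβ : 0 < α - 2 := by linarith
  have key : ∀ T : ℕ, ∑ t ∈ Icc 1 (T + 1), (t : ℝ) ^ (1 - α) ≤
      1 + (1 - ((T + 1 : ℕ) : ℝ) ^ (2 - α)) / (α - 2) := by
    intro T
    induction T with
    | zero => simp
    | succ T ih =>
      rw [Finset.sum_Icc_succ_top (by omega)]
      set x : ℝ := ((T + 1 : ℕ) : ℝ) with hx
      have hx0 : 0 < x := by positivity
      have hx1 : ((T + 1 + 1 : ℕ) : ℝ) = x + 1 := by push_cast [hx]; ring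
      rw [hx1]
      have hlog : 1 / (x + 1) ≤ Real.log ((x + 1) / x) := by
        have := Real.one_sub_inv_le_log_of_pos (x := (x + 1) / x) (by positivity)
        refine le_trans (le_of_eq ?_) this
        field_simp
        ring
      -- A Bernoulli-type inequality from `log y ≥ 1 - 1 / y` and `exp z ≥ 1 + z`; it is what makes
      -- one term smaller than its telescoping increment.
      have h1 : 1 + (α - 2) / (x + 1) ≤ ((x + 1) / x) ^ (α - 2) := by
        rw [Real.rpow_def_of_pos (by positivity)]
        have := Real.add_one_le_exp (Real.log ((x + 1) / x) * (α - 2))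
        have h2 := mul_le_mul_of_nonneg_right hlog hβ.le
        rw [one_div_mul_eq_div] at h2
        linarith
      have h2 : x ^ (2 - α) = ((x + 1) / x) ^ (α - 2) * (x + 1) ^ (2 - α) := by
        rw [Real.div_rpow (by positivity) hx0.le, show 2 - α = -(α - 2) by ring,
          Real.rpow_neg (by positivity), Real.rpow_neg (by positivity)]
        field_simp
      have h3 : (x + 1) ^ (1 - α) = (x + 1) ^ (2 - α) / (x + 1) := by
        rw [show 1 - α = (2 - α) - 1 by ring, Real.rpow_sub_one (by positivity)]
      have h4 : 0 < (x + 1) ^ (2 - α) := by positivity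
      have h5 : (x + 1) ^ (1 - α) ≤ (x ^ (2 - α) - (x + 1) ^ (2 - α)) / (α - 2) := by
        rw [le_div_iff₀ hβ, h3, h2]
        have := mul_le_mul_of_nonneg_right h1 h4.le
        have h6 : (x + 1) ^ (2 - α) / (x + 1) * (α - 2) =
          (α - 2) / (x + 1) * (x + 1) ^ (2 - α) := by ring
        rw [h6]
        linarith
      calc _ ≤ 1 + (1 - x ^ (2 - α)) / (α - 2) +
            (x ^ (2 - α) - (x + 1) ^ (2 - α)) / (α - 2) := add_le_add ih h5
        _ = _ := by ring
  rcases T with _ | T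
  · simp only [Nat.lt_one_iff, pos_of_gt, Icc_eq_empty_of_lt, Finset.sum_empty]
    positivity
  · refine (key T).trans ?_
    have : 0 < ((T + 1 : ℕ) : ℝ) ^ (2 - α) := by positivity
    rw [le_div_iff₀ hβ, add_mul, div_mul_cancel₀ _ hβ.ne']
    linarith

section Rewards

variable {N L : ℕ} {K : Market N L} {Ω : Type*} [mΩ : MeasurableSpace Ω] {P : Measure Ω}

theorem initCount_pos (E : Environment K P) (a : Agent N L) (b : Partner a) :
    0 < initCount E.T₀ a b := by
  rcases a with u | p
  · exact E.T₀_pos u b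
  · exact E.T₀_pos b p

theorem initCount_le_count (E : Environment K P) (M : Mechanism N L) (t : ℕ) (a : Agent N L)
    (b : Partner a) (ω : Ω) : initCount E.T₀ a b ≤ (E.stats M ω t).count a b := by
  rw [E.stats_count]
  exact Nat.le_add_right _ _

theorem count_le (E : Environment K P) (M : Mechanism N L) (t : ℕ) (a : Agent N L)
    (b : Partner a) (ω : Ω) : (E.stats M ω t).count a b ≤ initCount E.T₀ a b + t := by
  rw [E.stats_count]
  gcongr
  refine (Finset.sum_le_card_nsmul _ _ 1 fun τ _ => ?_).trans (by simp)
  split_ifs <;> simp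

/-- The width of the confidence bound at time `t` after `n` samples. -/
noncomputable def width (E : Environment K P) (t n : ℕ) : ℝ :=
  Real.sqrt (2 * (E.σ : ℝ) ^ 2 * E.α * Real.log t / n)

/-- The deviation of the sample mean in the direction `e` exceeds the confidence width. -/
def failure (E : Environment K P) (M : Mechanism N L) (e : ℝ) (t : ℕ) (a : Agent N L)
    (b : Partner a) : Set Ω :=
  {ω | (E.stats M ω (t - 1)).count a b * width E t ((E.stats M ω (t - 1)).count a b) <
    e * deviation E M (t - 1) a b ω}

theorem measure_failure_count_le [IsProbabilityMeasure P] (E : Environment K P)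
    (M : Mechanism N L) {e : ℝ} (he : e ^ 2 = 1) {t : ℕ} (ht : 1 ≤ t) (a : Agent N L)
    (b : Partner a) {n : ℕ} (hn : 0 < n) :
    P {ω | (E.stats M ω (t - 1)).count a b = n ∧
      n * width E t n < e * deviation E M (t - 1) a b ω} ≤ ENNReal.ofReal ((t : ℝ) ^ (-E.α)) := by
  have hn' : (0 : ℝ) < n := by exact_mod_cast hn
  have hlog : 0 ≤ Real.log t := Real.log_natCast_nonneg t
  have hα : 0 < E.α := by linarith [E.two_lt_α]
  -- For `σ = 0` the optimal Chernoff parameter is undefined. The bound then holds with every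
  -- parameter `k`, and `k → ∞` shows that positive deviations are null.
  rcases eq_or_ne (E.σ : ℝ) 0 with hσ | hσ
  · have hw : width E t n = 0 := by simp [width, hσ]
    have hnull : ∀ x : ℝ, 0 < x → P {ω | (E.stats M ω (t - 1)).count a b = n ∧
        x ≤ e * deviation E M (t - 1) a b ω} = 0 := by
      intro x hx
      have h1 : ∀ k : ℕ, P {ω | (E.stats M ω (t - 1)).count a b = n ∧
          x ≤ e * deviation E M (t - 1) a b ω} ≤ ENNReal.ofReal (Real.exp (-(k * x))) := by
        intro k
        have h2 := measure_deviation_le E M a b (k * e) (k * x) (t - 1) n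
        simp only [hσ, ne_eq, OfNat.ofNat_ne_zero, not_false_eq_true, zero_pow, mul_zero,
          zero_div, zero_mul, zero_sub] at h2
        refine (measure_mono ?_).trans h2
        rintro ω ⟨h3, h4⟩
        refine ⟨h3, ?_⟩
        rw [mul_assoc]
        exact mul_le_mul_of_nonneg_left h4 (Nat.cast_nonneg k)
      have h2 : Tendsto (fun k : ℕ => ENNReal.ofReal (Real.exp (-(k * x)))) atTop (nhds 0) := by
        rw [← ENNReal.ofReal_zero]
        refine (ENNReal.continuous_ofReal.tendsto 0).comp ?_
        exact Real.tendsto_exp_neg_atTop_nhds_zero.comp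
          (tendsto_natCast_atTop_atTop.atTop_mul_const hx)
      exact le_antisymm (ge_of_tendsto' h2 h1) bot_le
    rw [hw, mul_zero]
    have hsub : {ω | (E.stats M ω (t - 1)).count a b = n ∧
        0 < e * deviation E M (t - 1) a b ω} ⊆ ⋃ k : ℕ,
          {ω | (E.stats M ω (t - 1)).count a b = n ∧
            1 / ((k : ℝ) + 1) ≤ e * deviation E M (t - 1) a b ω} := by
      rintro ω ⟨h1, h2⟩
      obtain ⟨k, hk⟩ := exists_nat_one_div_lt h2
      exact Set.mem_iUnion.2 ⟨k, h1, hk.le⟩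
    rw [measure_mono_null hsub (measure_iUnion_null fun k => hnull _ (by positivity))]
    exact bot_le
  · have hσ2 : 0 < (E.σ : ℝ) ^ 2 := by positivity
    set B := width E t n with hB
    have hB0 : 0 ≤ B := Real.sqrt_nonneg _
    have hB2 : n * B ^ 2 = 2 * (E.σ : ℝ) ^ 2 * E.α * Real.log t := by
      rw [hB, width, Real.sq_sqrt (by positivity)]
      field_simp
    -- With `B` the width, the parameter `B / σ²` minimizes the Chernoff exponent, leaving `-n B² /
    -- (2σ²) = -α log t`.
    have h := measure_deviation_le E M a b (e * (B / (E.σ : ℝ) ^ 2)) (n * B ^ 2 / (E.σ : ℝ) ^ 2)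
      (t - 1) n
    refine (measure_mono ?_).trans (h.trans (le_of_eq ?_))
    · rintro ω ⟨h3, h4⟩
      refine ⟨h3, ?_⟩
      have : n * B ^ 2 / (E.σ : ℝ) ^ 2 = (n * B) * (B / (E.σ : ℝ) ^ 2) := by ring
      rw [this, mul_right_comm e]
      exact mul_le_mul_of_nonneg_right h4.le (by positivity)
    · congr 1
      have : (e * (B / (E.σ : ℝ) ^ 2)) ^ 2 * (E.σ : ℝ) ^ 2 / 2 * n -
          n * B ^ 2 / (E.σ : ℝ) ^ 2 = -(n * B ^ 2) / (2 * (E.σ : ℝ) ^ 2) := by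
        rw [mul_pow, he]
        field_simp
        ring
      rw [this, hB2, Real.rpow_def_of_pos (by exact_mod_cast ht)]
      congr 1
      field_simp

/-- The count is random, but after `t - 1` rounds it takes one of `t` values starting from the
initial count. The union bound costs a factor `t`, so summability in `t` needs `α > 2`. -/
theorem measure_failure_le [IsProbabilityMeasure P] (E : Environment K P)
    (M : Mechanism N L) {e : ℝ} (he : e ^ 2 = 1) {t : ℕ} (ht : 1 ≤ t) (a : Agent N L)
    (b : Partner a) : P.real (failure E M e t a b) ≤ (t : ℝ) ^ (1 - E.α) := by
  have ht' : (0 : ℝ) < t := by exact_mod_cast ht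
  set n₀ := initCount E.T₀ a b
  have hsub : failure E M e t a b ⊆ ⋃ k ∈ Finset.range t,
      {ω | (E.stats M ω (t - 1)).count a b = n₀ + k ∧
        ((n₀ + k : ℕ) : ℝ) * width E t (n₀ + k) < e * deviation E M (t - 1) a b ω} := by
    intro ω hω
    have h1 := initCount_le_count E M (t - 1) a b ω
    have h2 := count_le E M (t - 1) a b ω
    obtain ⟨k, hk⟩ := Nat.exists_eq_add_of_le h1
    simp only [Set.mem_iUnion, Finset.mem_range]
    refine ⟨k, by omega, hk, ?_⟩
    have h3 : (E.stats M ω (t - 1)).count a b * width E t ((E.stats M ω (t - 1)).count a b) <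
      e * deviation E M (t - 1) a b ω := hω
    rw [hk] at h3
    exact h3
  have h1 : P (failure E M e t a b) ≤ ENNReal.ofReal ((t : ℝ) ^ (1 - E.α)) := by
    refine (measure_mono hsub).trans ((measure_biUnion_finset_le _ _).trans ?_)
    refine (Finset.sum_le_card_nsmul _ _ _ fun k _ => measure_failure_count_le E M he ht a b
      (Nat.add_pos_left (initCount_pos E a b) k)).trans (le_of_eq ?_)
    rw [Finset.card_range, nsmul_eq_mul, ← ENNReal.ofReal_natCast t,
      ← ENNReal.ofReal_mul ht'.le, sub_eq_add_neg, Real.rpow_add ht', Real.rpow_one]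
  exact ENNReal.toReal_le_of_le_ofReal (by positivity) h1

/-- The number of times an agent is given a match it has sampled at most `c` times. -/
theorem sum_indicator_count_le (E : Environment K P) (M : Mechanism N L) (a : Agent N L)
    (b : Partner a) {c : ℝ} (hc : 0 ≤ c) (T : ℕ) (ω : Ω) :
    ∑ t ∈ Icc 1 T, Set.indicator {ω | E.matching M t ω a = some b ∧
      ((E.stats M ω (t - 1)).count a b : ℝ) ≤ c} (fun _ => (1 : ℝ)) ω ≤ c := by
  -- The second conjunct strengthens the induction: the initial sample keeps the sum at least one
  -- below the count, which gives the bound `c` instead of `c + 1`.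
  suffices h : ∑ t ∈ Icc 1 T, Set.indicator {ω | E.matching M t ω a = some b ∧
      ((E.stats M ω (t - 1)).count a b : ℝ) ≤ c} (fun _ => (1 : ℝ)) ω ≤ c ∧
      ∑ t ∈ Icc 1 T, Set.indicator {ω | E.matching M t ω a = some b ∧
      ((E.stats M ω (t - 1)).count a b : ℝ) ≤ c} (fun _ => (1 : ℝ)) ω + 1 ≤
        (E.stats M ω T).count a b from h.1
  induction T with
  | zero =>
    have := (initCount_pos E a b).trans_le (initCount_le_count E M 0 a b ω)
    simpa [hc, Nat.succ_le_iff] using this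
  | succ T ih =>
    have hcount : (E.stats M ω (T + 1)).count a b = (E.stats M ω T).count a b +
        if E.matching M (T + 1) ω a = some b then 1 else 0 := rfl
    rw [Finset.sum_Icc_succ_top (by omega), hcount, Nat.add_sub_cancel]
    by_cases h1 : E.matching M (T + 1) ω a = some b
    · by_cases h2 : ((E.stats M ω T).count a b : ℝ) ≤ c
      · have hmem : ω ∈ {ω | E.matching M (T + 1) ω a = some b ∧
            ((E.stats M ω T).count a b : ℝ) ≤ c} := ⟨h1, h2⟩
        rw [Set.indicator_of_mem hmem, if_pos h1]
        push_cast
        exact ⟨ih.2.trans h2, by linarith [ih.2]⟩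
      · rw [Set.indicator_of_notMem fun h => h2 h.2, if_pos h1]
        push_cast
        exact ⟨by linarith [ih.1], by linarith [ih.2]⟩
    · rw [Set.indicator_of_notMem fun h => h1 h.1, if_neg h1]
      push_cast
      exact ⟨by linarith [ih.1], by linarith [ih.2]⟩

theorem sum_measure_count_le [IsProbabilityMeasure P] (E : Environment K P) (M : Mechanism N L)
    (a : Agent N L) (b : Partner a) {c : ℝ} (hc : 0 ≤ c) (T : ℕ) :
    ∑ t ∈ Icc 1 T, P.real {ω | E.matching M t ω a = some b ∧
      ((E.stats M ω (t - 1)).count a b : ℝ) ≤ c} ≤ c := by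
  have hm : ∀ t, MeasurableSet {ω | E.matching M t ω a = some b ∧
      ((E.stats M ω (t - 1)).count a b : ℝ) ≤ c} := by
    intro t
    have h1 := E.history_le _ _ (measurableSet_matching E M t {m | m a = some b})
    have h2 : MeasurableSet {ω | ((E.stats M ω (t - 1)).count a b : ℝ) ≤ c} :=
      (((measurable_stats E M (t - 1)).1 a b).mono (E.history_le _) le_rfl)
        (MeasurableSet.of_discrete (s := {n : ℕ | (n : ℝ) ≤ c}))
    exact h1.inter h2
  calc _ = ∑ t ∈ Icc 1 T, ∫ ω, Set.indicator {ω | E.matching M t ω a = some b ∧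
      ((E.stats M ω (t - 1)).count a b : ℝ) ≤ c} (fun _ => (1 : ℝ)) ω ∂P := by
        refine Finset.sum_congr rfl fun t _ => ?_
        rw [integral_indicator_const _ (hm t), smul_eq_mul, mul_one]
    _ = ∫ ω, ∑ t ∈ Icc 1 T, Set.indicator {ω | E.matching M t ω a = some b ∧
      ((E.stats M ω (t - 1)).count a b : ℝ) ≤ c} (fun _ => (1 : ℝ)) ω ∂P :=
        (integral_finsetSum _ fun t _ => (integrable_const _).indicator (hm t)).symm
    _ ≤ ∫ _, c ∂P := by
        refine integral_mono_of_nonneg (ae_of_all _ fun ω => ?_) (integrable_const _)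
          (ae_of_all _ fun ω => sum_indicator_count_le E M a b hc T ω)
        exact Finset.sum_nonneg fun t _ => Set.indicator_nonneg (fun _ _ => zero_le_one) _
    _ = c := by simp

/-! ### Mistakes -/

theorem Market.gapMin_le (K : Market N L) (a : Agent N L) {b c : Option (Partner a)}
    (h : b ≠ c) : K.gapMin ≤ |K.μ a b - K.μ a c| :=
  csInf_le ⟨0, by rintro d ⟨a, b, c, -, rfl⟩; positivity⟩ ⟨a, b, c, h, rfl⟩

/-- A finite infimum is attained, and true preferences have no ties. The pair `b ≠ c` is needed for
nonemptiness, since `sInf ∅ = 0`. -/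
theorem Market.gapMin_pos (K : Market N L) (a : Agent N L) {b c : Option (Partner a)}
    (h : b ≠ c) : 0 < K.gapMin := by
  have hfin : {d | ∃ (a : Agent N L) (b c : Option (Partner a)),
      b ≠ c ∧ d = |K.μ a b - K.μ a c|}.Finite := by
    refine (Set.finite_range fun i : (Σ a : Agent N L, Option (Partner a) × Option (Partner a)) =>
      |K.μ i.1 i.2.1 - K.μ i.1 i.2.2|).subset ?_
    rintro d ⟨a, b, c, -, rfl⟩
    exact ⟨⟨a, b, c⟩, rfl⟩
  have hne : {d | ∃ (a : Agent N L) (b c : Option (Partner a)),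
      b ≠ c ∧ d = |K.μ a b - K.μ a c|}.Nonempty := ⟨_, a, b, c, h, rfl⟩
  obtain ⟨a', b', c', h', h''⟩ := hne.csInf_mem hfin
  rw [Market.gapMin, h'', abs_pos, sub_ne_zero]
  exact fun h => h' (K.μ_injective a' h)

/-- Under the preferences reported at time `t`, some agent does not prefer a truly better match
over the one it is given. -/
def mistake (E : Environment K P) (M : Mechanism N L) (t : ℕ) : Set Ω :=
  {ω | ∃ (a : Agent N L) (c : Option (Partner a)), K.μ a (E.matching M t ω a) < K.μ a c ∧
    E.ν M t ω a c ≤ E.ν M t ω a (E.matching M t ω a)}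

theorem ν_some (E : Environment K P) (M : Mechanism N L) (t : ℕ) (ω : Ω) (a : Agent N L)
    (b : Partner a) : E.ν M t ω a (some b) = K.μ a (some b) +
      deviation E M (t - 1) a b ω / (E.stats M ω (t - 1)).count a b +
        width E t ((E.stats M ω (t - 1)).count a b) := by
  have h := (initCount_pos E a b).trans_le (initCount_le_count E M (t - 1) a b ω)
  have h' : ((E.stats M ω (t - 1)).count a b : ℝ) ≠ 0 := by exact_mod_cast h.ne'
  change (E.stats M ω (t - 1)).total a b / (E.stats M ω (t - 1)).count a b + _ = _
  rw [deviation, sub_div, mul_div_cancel_right₀ _ h', add_sub_cancel]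
  rfl

theorem le_ν_of_notMem_failure (E : Environment K P) (M : Mechanism N L) {t : ℕ} {ω : Ω}
    {a : Agent N L} {b : Partner a} (h : ω ∉ failure E M (-1) t a b) :
    K.μ a (some b) ≤ E.ν M t ω a (some b) := by
  have h0 := (initCount_pos E a b).trans_le (initCount_le_count E M (t - 1) a b ω)
  have h' : (0 : ℝ) < (E.stats M ω (t - 1)).count a b := by exact_mod_cast h0
  rw [failure, Set.mem_ofPred_eq, not_lt, ← div_le_iff₀' h', neg_one_mul, neg_div] at h
  rw [ν_some]
  linarith

theorem ν_le_of_notMem_failure (E : Environment K P) (M : Mechanism N L) {t : ℕ} {ω : Ω}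
    {a : Agent N L} {b : Partner a} (h : ω ∉ failure E M 1 t a b) :
    E.ν M t ω a (some b) ≤ K.μ a (some b) +
      2 * width E t ((E.stats M ω (t - 1)).count a b) := by
  have h0 := (initCount_pos E a b).trans_le (initCount_le_count E M (t - 1) a b ω)
  have h' : (0 : ℝ) < (E.stats M ω (t - 1)).count a b := by exact_mod_cast h0
  rw [failure, Set.mem_ofPred_eq, not_lt, ← div_le_iff₀' h', one_mul] at h
  rw [ν_some]
  linarith

/-- If both confidence bounds hold, then `μ c ≤ ν c ≤ ν b ≤ μ b + 2 * width`, so `gapMin ≤ 2 *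
width`; solving for the count gives the threshold, made uniform in time by `log t ≤ log T`. Being
unmatched is reported exactly as 0, so it yields no further case. -/
theorem mistake_subset (E : Environment K P) (M : Mechanism N L) {t T : ℕ} (ht : 1 ≤ t)
    (htT : t ≤ T) : mistake E M t ⊆ ⋃ i ∈ (Finset.univ : Finset (Σ a : Agent N L, Partner a)),
      (failure E M 1 t i.1 i.2 ∪ failure E M (-1) t i.1 i.2) ∪
        {ω | E.matching M t ω i.1 = some i.2 ∧ ((E.stats M ω (t - 1)).count i.1 i.2 : ℝ) ≤
          8 * (E.σ : ℝ) ^ 2 * E.α * Real.log T / K.gapMin ^ 2} := by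
  rintro ω ⟨a, c, h1, h2⟩
  simp only [Finset.mem_univ, Set.iUnion_true, Set.mem_iUnion]
  rcases c with _ | c
  · rw [K.μ_none] at h1
    exact absurd (K.μ_nonneg _ _) (not_le.2 h1)
  by_cases hc : ω ∈ failure E M (-1) t a c
  · exact ⟨⟨a, c⟩, Or.inl (Or.inr hc)⟩
  have h3 := le_ν_of_notMem_failure E M hc
  rcases hb : E.matching M t ω a with _ | b
  · rw [hb] at h1 h2
    have : E.ν M t ω a none = 0 := rfl
    rw [K.μ_none] at h1
    linarith
  · rw [hb] at h1 h2
    refine ⟨⟨a, b⟩, ?_⟩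
    by_cases hf : ω ∈ failure E M 1 t a b
    · exact Or.inl (Or.inl hf)
    refine Or.inr ⟨hb, ?_⟩
    have h4 := ν_le_of_notMem_failure E M hf
    have hne : some c ≠ some b := fun h => by rw [h] at h1; exact lt_irrefl _ h1
    have hgap := K.gapMin_le a hne
    have hpos := K.gapMin_pos a hne
    rw [abs_of_pos (by linarith)] at hgap
    set n := (E.stats M ω (t - 1)).count a b with hn
    have h0 : 0 < n := (initCount_pos E a b).trans_le (initCount_le_count E M (t - 1) a b ω)
    have h0' : (0 : ℝ) < n := by exact_mod_cast h0
    have h5 : K.gapMin ≤ 2 * width E t n := by linarith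
    have hlog : 0 ≤ Real.log t := Real.log_natCast_nonneg t
    have hα : 0 < E.α := by linarith [E.two_lt_α]
    have h6 : K.gapMin ^ 2 ≤ 8 * (E.σ : ℝ) ^ 2 * E.α * Real.log t / n := by
      refine (pow_le_pow_left₀ hpos.le h5 2).trans (le_of_eq ?_)
      rw [mul_pow, width, Real.sq_sqrt (by positivity)]
      ring
    have h7 : Real.log t ≤ Real.log T :=
      Real.log_le_log (by exact_mod_cast ht) (by exact_mod_cast htT)
    change (n : ℝ) ≤ _
    rw [le_div_iff₀ (by positivity)]
    rw [le_div_iff₀ h0'] at h6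
    calc n * K.gapMin ^ 2 = K.gapMin ^ 2 * n := mul_comm _ _
      _ ≤ _ := h6
      _ ≤ _ := by gcongr

/-- The expected number of mistakes is logarithmic. -/
theorem sum_measure_mistake_le [IsProbabilityMeasure P] (E : Environment K P)
    (M : Mechanism N L) (T : ℕ) :
    ∑ t ∈ Icc 1 T, P.real (mistake E M t) ≤ 2 * (N : ℝ) * L *
      (8 * (E.σ : ℝ) ^ 2 * E.α * Real.log T / K.gapMin ^ 2 + 2 * (E.α / (E.α - 2))) := by
  have hα : 0 < E.α := by linarith [E.two_lt_α]
  have hlog : 0 ≤ Real.log T := Real.log_natCast_nonneg T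
  set c := 8 * (E.σ : ℝ) ^ 2 * E.α * Real.log T / K.gapMin ^ 2 with hc
  have hc0 : 0 ≤ c := by positivity
  calc ∑ t ∈ Icc 1 T, P.real (mistake E M t)
      ≤ ∑ t ∈ Icc 1 T, ∑ i : (Σ a : Agent N L, Partner a), (2 * (t : ℝ) ^ (1 - E.α) +
          P.real {ω | E.matching M t ω i.1 = some i.2 ∧
            ((E.stats M ω (t - 1)).count i.1 i.2 : ℝ) ≤ c}) := by
        refine Finset.sum_le_sum fun t ht => ?_
        rw [Finset.mem_Icc] at ht
        refine (measureReal_mono (mistake_subset E M ht.1 ht.2) (measure_ne_top _ _)).trans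
          ((measureReal_biUnion_finset_le _ _).trans (Finset.sum_le_sum fun i _ => ?_))
        refine (measureReal_union_le _ _).trans (add_le_add_left ?_ _)
        refine (measureReal_union_le _ _).trans ?_
        have h1 := measure_failure_le E M (e := 1) (by norm_num) ht.1 i.1 i.2
        have h2 := measure_failure_le E M (e := -1) (by norm_num) ht.1 i.1 i.2
        linarith
    _ = ∑ i : (Σ a : Agent N L, Partner a), (2 * ∑ t ∈ Icc 1 T, (t : ℝ) ^ (1 - E.α) +
          ∑ t ∈ Icc 1 T, P.real {ω | E.matching M t ω i.1 = some i.2 ∧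
            ((E.stats M ω (t - 1)).count i.1 i.2 : ℝ) ≤ c}) := by
        rw [Finset.sum_comm]
        simp_rw [Finset.sum_add_distrib, Finset.mul_sum]
    _ ≤ ∑ i : (Σ a : Agent N L, Partner a), (2 * (E.α / (E.α - 2)) + c) := by
        refine Finset.sum_le_sum fun i _ => ?_
        have h1 := sum_rpow_le E.two_lt_α T
        have h2 := sum_measure_count_le E M i.1 i.2 hc0 T
        linarith
    _ = _ := by
        have hcard : Fintype.card (Σ a : Agent N L, Partner a) = 2 * (N * L) := by
          rw [Fintype.card_sigma, Fintype.sum_sum_type]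
          have h1 : ∀ u : Fin N, Fintype.card (Partner (Sum.inl u : Agent N L)) = L :=
            fun u => Fintype.card_fin L
          have h2 : ∀ p : Fin L, Fintype.card (Partner (Sum.inr p : Agent N L)) = N :=
            fun u => Fintype.card_fin N
          simp only [h1, h2, Finset.sum_const, Finset.card_univ, Fintype.card_fin, smul_eq_mul]
          ring
        rw [Finset.sum_const, Finset.card_univ, hcard, nsmul_eq_mul]
        push_cast
        ring

end Rewards

/-! ### Regret -/

section Rewards

variable {N L : ℕ} {K : Market N L} {Ω : Type*} [mΩ : MeasurableSpace Ω] {P : Measure Ω}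

@[simp]
theorem payoff_zeroRule (ψ : Pref N L) : payoff zeroRule zeroRule ψ = ψ := by
  funext a b
  simp [payoff, zeroRule]

@[simp]
theorem observed_zeroRule (E : Environment K P) (M : Mechanism N L) (t : ℕ) (a : Agent N L)
    (b : Option (Partner a)) (ω : Ω) :
    E.observed zeroRule zeroRule M t a b ω = E.reward t a b ω := by
  simp [Environment.observed, zeroRule]

theorem integrable_X [IsProbabilityMeasure P] (E : Environment K P) (t : ℕ) (a : Agent N L)
    (b : Partner a) : Integrable (E.X t a b) P := by
  have h : HasSubgaussianMGF (fun ω => E.X t a b ω - K.μ a (some b)) (E.σ ^ 2) P :=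
    HasSubgaussianMGF.of_map (X := fun x : ℝ => x - K.μ a (some b))
      (E.measurable_X t a b).aemeasurable (by rw [E.law_X]; exact E.subgaussian_D a b)
  refine (h.integrable.add (integrable_const (K.μ a (some b)))).congr (ae_of_all _ fun ω => ?_)
  simp

theorem integral_X (E : Environment K P) (t : ℕ) (a : Agent N L)
    (b : Partner a) : ∫ ω, E.X t a b ω ∂P = K.μ a (some b) := by
  rw [← E.mean_D, ← E.law_X t a b]
  exact (integral_map (E.measurable_X t a b).aemeasurable
    measurable_id.aestronglyMeasurable).symm

theorem integrable_reward [IsProbabilityMeasure P] (E : Environment K P) (t : ℕ) (a : Agent N L)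
    (b : Option (Partner a)) : Integrable (E.reward t a b) P := by
  rcases b with _ | b
  · exact integrable_zero _ _ _
  · exact integrable_X E t a b

theorem integral_reward (E : Environment K P) (t : ℕ) (a : Agent N L)
    (b : Option (Partner a)) : ∫ ω, E.reward t a b ω ∂P = K.μ a b := by
  rcases b with _ | b
  · rw [K.μ_none]
    exact integral_zero _ _
  · exact integral_X E t a b

/-- A random match is split into predictable indicators times rewards, so that independence can be
used term by term. -/
theorem reward_matching_eq_sum (E : Environment K P) (M : Mechanism N L) (t : ℕ) (a : Agent N L)
    (ω : Ω) : E.reward t a (E.matching M t ω a) ω = ∑ b, Set.indicator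
      {ω | E.matching M t ω a = some b} (fun _ => (1 : ℝ)) ω * E.X t a b ω := by
  rcases h : E.matching M t ω a with _ | b
  · refine (Finset.sum_eq_zero fun b _ => ?_).symm
    rw [Set.indicator_of_notMem (by simp [h]), zero_mul]
  · rw [Finset.sum_eq_single b]
    · rw [Set.indicator_of_mem (by simp [h]), one_mul]
      rfl
    · intro b' _ hb'
      rw [Set.indicator_of_notMem (by simpa [h] using hb'.symm), zero_mul]
    · simp

theorem μ_matching_eq_sum (E : Environment K P) (M : Mechanism N L) (t : ℕ) (a : Agent N L)
    (ω : Ω) : K.μ a (E.matching M t ω a) = ∑ b, Set.indicator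
      {ω | E.matching M t ω a = some b} (fun _ => (1 : ℝ)) ω * K.μ a (some b) := by
  rcases h : E.matching M t ω a with _ | b
  · rw [K.μ_none]
    refine (Finset.sum_eq_zero fun b _ => ?_).symm
    rw [Set.indicator_of_notMem (by simp [h]), zero_mul]
  · rw [Finset.sum_eq_single b]
    · rw [Set.indicator_of_mem (by simp [h]), one_mul]
    · intro b' _ hb'
      rw [Set.indicator_of_notMem (by simpa [h] using hb'.symm), zero_mul]
    · simp

theorem measurableSet_matching_eq (E : Environment K P) (M : Mechanism N L) (t : ℕ)
    (a : Agent N L) (b : Partner a) : MeasurableSet {ω | E.matching M t ω a = some b} :=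
  E.history_le _ _ (measurableSet_matching E M t {m | m a = some b})

theorem integrable_indicator_mul_X [IsProbabilityMeasure P] (E : Environment K P)
    (M : Mechanism N L) (t : ℕ) (a : Agent N L) (b : Partner a) :
    Integrable (fun ω => Set.indicator {ω | E.matching M t ω a = some b} (fun _ => (1 : ℝ)) ω *
      E.X t a b ω) P := by
  have h := (integrable_X E t a b).indicator (measurableSet_matching_eq E M t a b)
  refine h.congr (ae_of_all _ fun ω => ?_)
  by_cases hω : ω ∈ {ω | E.matching M t ω a = some b}
  · simp only [Set.indicator_of_mem hω, one_mul]
  · simp only [Set.indicator_of_notMem hω, zero_mul]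

theorem integrable_indicator_mul_μ [IsProbabilityMeasure P] (E : Environment K P)
    (M : Mechanism N L) (t : ℕ) (a : Agent N L) (b : Partner a) :
    Integrable (fun ω => Set.indicator {ω | E.matching M t ω a = some b} (fun _ => (1 : ℝ)) ω *
      K.μ a (some b)) P :=
  ((integrable_const _).indicator (measurableSet_matching_eq E M t a b)).mul_const _

theorem integrable_reward_matching [IsProbabilityMeasure P] (E : Environment K P)
    (M : Mechanism N L) (t : ℕ) (a : Agent N L) :
    Integrable (fun ω => E.reward t a (E.matching M t ω a) ω) P := by
  simp_rw [reward_matching_eq_sum]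
  exact integrable_finsetSum _ fun b _ => integrable_indicator_mul_X E M t a b

theorem integrable_μ_matching [IsProbabilityMeasure P] (E : Environment K P)
    (M : Mechanism N L) (t : ℕ) (a : Agent N L) :
    Integrable (fun ω => K.μ a (E.matching M t ω a)) P := by
  simp_rw [μ_matching_eq_sum]
  exact integrable_finsetSum _ fun b _ => integrable_indicator_mul_μ E M t a b

theorem integral_reward_matching [IsProbabilityMeasure P] (E : Environment K P)
    (M : Mechanism N L) {t : ℕ} (ht : 1 ≤ t) (a : Agent N L) :
    ∫ ω, E.reward t a (E.matching M t ω a) ω ∂P = ∫ ω, K.μ a (E.matching M t ω a) ∂P := by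
  simp_rw [reward_matching_eq_sum, μ_matching_eq_sum]
  rw [integral_finsetSum _ fun b _ => integrable_indicator_mul_X E M t a b,
    integral_finsetSum _ fun b _ => integrable_indicator_mul_μ E M t a b]
  refine Finset.sum_congr rfl fun b _ => ?_
  obtain ⟨t, rfl⟩ := Nat.exists_eq_add_of_le' ht
  have hA := measurableSet_matching E M (t + 1) {m | m a = some b}
  have hind : IndepFun (Set.indicator {ω | E.matching M (t + 1) ω a = some b}
      (fun _ => (1 : ℝ))) (E.X (t + 1) a b) P := by
    rw [IndepFun_iff_Indep]
    refine indep_of_indep_of_le_left (E.indep_history t a b) (Measurable.comap_le ?_)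
    exact Measurable.indicator measurable_const hA
  rw [hind.integral_fun_mul_eq_mul_integral
    ((measurable_const.indicator (measurableSet_matching_eq E M (t + 1) a b))).aestronglyMeasurable
    (E.measurable_X _ _ _).aestronglyMeasurable, integral_X, integral_mul_const]

/-- The expected rewards can be replaced by the true preferences. -/
theorem integral_regret [IsProbabilityMeasure P] (E : Environment K P) (M : Mechanism N L)
    (a : Agent N L) (g : ℕ → Assignment N L) (T : ℕ) :
    ∫ ω, ∑ t ∈ Icc 1 T, (E.observed zeroRule zeroRule M t a (g t a) ω -
      E.observed zeroRule zeroRule M t a (E.matching M t ω a) ω) ∂P =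
    ∑ t ∈ Icc 1 T, ∫ ω, (K.μ a (g t a) - K.μ a (E.matching M t ω a)) ∂P := by
  simp only [observed_zeroRule]
  have hint : ∀ t, Integrable (fun ω => E.reward t a (g t a) ω -
      E.reward t a (E.matching M t ω a) ω) P :=
    fun t => (integrable_reward E t a (g t a)).sub (integrable_reward_matching E M t a)
  rw [integral_finsetSum _ fun t _ => hint t]
  refine Finset.sum_congr rfl fun t ht => ?_
  rw [integral_sub (integrable_reward E t a (g t a)) (integrable_reward_matching E M t a),
    integral_sub (integrable_const _) (integrable_μ_matching E M t a), integral_reward,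
    integral_reward_matching E M (Finset.mem_Icc.1 ht).1]
  simp

/-- The stable set is finite, and nonempty because Gale–Shapley terminates; a maximizer therefore
exists and `Classical.epsilon` picks one. Expected rewards are true preferences. -/
theorem optimalMatching_spec (E : Environment K P) (M : Mechanism N L) (t : ℕ) (a : Agent N L) :
    optimalMatching E zeroRule zeroRule M t a ∈ stableSet K.μ ∧ ∀ m' ∈ stableSet K.μ,
      K.μ a (m' a) ≤ K.μ a (optimalMatching E zeroRule zeroRule M t a a) := by
  have h : ∃ m, IsOptimalFor E zeroRule zeroRule M t a m := by
    obtain ⟨m, hm, hm'⟩ := Set.exists_max_image (stableSet K.μ) (fun m => K.μ a (m a))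
      (Set.toFinite _) (stableSet_nonempty K.le K.μ)
    refine ⟨m, by simpa using hm, fun m' h' => ?_⟩
    simp only [observed_zeroRule, integral_reward]
    exact hm' m' (by simpa using h')
  have h2 := Classical.epsilon_spec h
  simp only [IsOptimalFor, observed_zeroRule, integral_reward, payoff_zeroRule] at h2
  simpa only [optimalMatching, IsOptimalFor, observed_zeroRule, integral_reward,
    payoff_zeroRule] using h2

theorem pessimalMatching_spec (E : Environment K P) (M : Mechanism N L) (t : ℕ) (a : Agent N L) :
    pessimalMatching E zeroRule zeroRule M t a ∈ stableSet K.μ ∧ ∀ m' ∈ stableSet K.μ,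
      K.μ a (pessimalMatching E zeroRule zeroRule M t a a) ≤ K.μ a (m' a) := by
  have h : ∃ m, IsPessimalFor E zeroRule zeroRule M t a m := by
    obtain ⟨m, hm, hm'⟩ := Set.exists_min_image (stableSet K.μ) (fun m => K.μ a (m a))
      (Set.toFinite _) (stableSet_nonempty K.le K.μ)
    refine ⟨m, by simpa using hm, fun m' h' => ?_⟩
    simp only [observed_zeroRule, integral_reward]
    exact hm' m' (by simpa using h')
  have h2 := Classical.epsilon_spec h
  simp only [IsPessimalFor, observed_zeroRule, integral_reward, payoff_zeroRule] at h2
  simpa only [pessimalMatching, IsPessimalFor, observed_zeroRule, integral_reward,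
    payoff_zeroRule] using h2

/-! ### From mistakes to regret -/

theorem measurableSet_mistake (E : Environment K P) (M : Mechanism N L) (t : ℕ) :
    MeasurableSet (mistake E M t) := by
  have h : mistake E M t = ⋃ (m : Assignment N L) (a : Agent N L) (c : Option (Partner a)),
      {ω | E.matching M t ω ∈ ({m} : Set (Assignment N L))} ∩
        ({ω | K.μ a (m a) < K.μ a c} ∩ {ω | E.ν M t ω a c ≤ E.ν M t ω a (m a)}) := by
    ext ω
    simp [mistake]
  have hν : Measurable (E.ν M t) := (measurable_ν E M t).mono (E.history_le _) le_rfl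
  rw [h]
  refine MeasurableSet.iUnion fun m => MeasurableSet.iUnion fun a => MeasurableSet.iUnion fun c =>
    (E.history_le _ _ (measurableSet_matching E M t {m})).inter
      ((MeasurableSet.const _).inter (measurableSet_le ?_ ?_))
  · exact (measurable_pi_apply c).comp ((measurable_pi_apply a).comp hν)
  · exact (measurable_pi_apply (m a)).comp ((measurable_pi_apply a).comp hν)

theorem lt_of_notMem_mistake (E : Environment K P) (M : Mechanism N L) {t : ℕ} {ω : Ω}
    (h : ω ∉ mistake E M t) {a : Agent N L} {c : Option (Partner a)}
    (hc : K.μ a (E.matching M t ω a) < K.μ a c) :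
    E.ν M t ω a (E.matching M t ω a) < E.ν M t ω a c :=
  lt_of_not_ge fun h' => h ⟨a, c, hc, h'⟩

/-- Without a mistake, both strict preferences of a truly blocking pair also appear in the reports,
so the pair would block there. -/
theorem mem_stableSet_of_notMem_mistake (E : Environment K P) (M : Mechanism N L) {t : ℕ} {ω : Ω}
    (hs : E.matching M t ω ∈ stableSet (E.ν M t ω)) (h : ω ∉ mistake E M t) :
    E.matching M t ω ∈ stableSet K.μ :=
  ⟨hs.1, fun u p hb => hs.2 u p
    ⟨lt_of_notMem_mistake E M h hb.1, lt_of_notMem_mistake E M h hb.2⟩⟩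

theorem integral_le_of_forall_notMem [IsProbabilityMeasure P] {D : Ω → ℝ} (hD : Integrable D P)
    {B : Set Ω} (hB : MeasurableSet B) {A C : ℝ} (h1 : ∀ ω ∉ B, D ω ≤ A)
    (h2 : ∀ ω, D ω ≤ A + C) : ∫ ω, D ω ∂P ≤ A + C * P.real B := by
  calc ∫ ω, D ω ∂P ≤ ∫ ω, (A + B.indicator (fun _ => C) ω) ∂P := by
        refine integral_mono hD ((integrable_const _).add ((integrable_const _).indicator hB))
          fun ω => ?_
        by_cases h : ω ∈ B
        · simpa [Set.indicator_of_mem h] using h2 ω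
        · simpa [Set.indicator_of_notMem h] using h1 ω h
    _ = A + C * P.real B := by
        rw [integral_add (integrable_const _) ((integrable_const _).indicator hB),
          integral_indicator_const _ hB]
        simp [mul_comm]

theorem Market.sub_le_gapMax (K : Market N L) (a : Agent N L) (b c : Option (Partner a)) :
    K.μ a b - K.μ a c ≤ K.gapMax a := by
  refine le_csSup (Set.Finite.bddAbove ?_) ⟨b, c, rfl⟩
  refine (Set.finite_range fun i : Option (Partner a) × Option (Partner a) =>
    K.μ a i.1 - K.μ a i.2).subset ?_
  rintro d ⟨b, c, rfl⟩
  exact ⟨(b, c), rfl⟩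

theorem mem_stableSet_of_feasible_of_le_one (hN : N ≤ 1) (V : Pref N L) {m : Assignment N L}
    (hm : Feasible m) : m ∈ stableSet V := by
  have : Subsingleton (Fin N) := Fin.subsingleton_iff_le_one.2 hN
  refine ⟨hm, fun u p hb => ?_⟩
  obtain ⟨u', hu'⟩ := Option.ne_none_iff_exists'.1 (hm.2 p)
  have h : (u' : Fin N) = u := Subsingleton.elim (α := Fin N) _ _
  have h2 := hb.2
  rw [hu', h] at h2
  exact lt_irrefl _ h2

theorem AppliesGS.incentiveCompatible {E : Environment K P} {C R : Rule N L} {M : Mechanism N L}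
    {T : ℕ} (h : AppliesGS E C R M T) : IncentiveCompatible E C R M T :=
  fun t ht ω => (h t ht ω).mem_stableSet

/-- Under incentive compatibility the pessimal regret is logarithmic. -/
theorem pessimalRegret_le [IsProbabilityMeasure P] (E : Environment K P) (M : Mechanism N L)
    (T : ℕ) (hIC : IncentiveCompatible E zeroRule zeroRule M T) (a : Agent N L) :
    pessimalRegret E zeroRule zeroRule M a T ≤ 2 * (N : ℝ) ^ 2 * L * K.gapMax a *
      (8 * (E.σ : ℝ) ^ 2 * E.α * Real.log T / K.gapMin ^ 2 + E.α / (E.α - 2)) := by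
  have hα : 0 < E.α := by linarith [E.two_lt_α]
  have hα2 : 0 < E.α - 2 := by linarith [E.two_lt_α]
  have hlog : 0 ≤ Real.log T := Real.log_natCast_nonneg T
  have hgap : 0 ≤ K.gapMax a := by simpa using K.sub_le_gapMax a none none
  set c := 8 * (E.σ : ℝ) ^ 2 * E.α * Real.log T / K.gapMin ^ 2 with hc
  have hc0 : 0 ≤ c := by positivity
  have hIC' : ∀ t ∈ Icc 1 T, ∀ ω, E.matching M t ω ∈ stableSet (E.ν M t ω) := by
    simpa [IncentiveCompatible] using hIC
  rw [pessimalRegret, integral_regret]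
  have hint : ∀ t, Integrable (fun ω => K.μ a (pessimalMatching E zeroRule zeroRule M t a a) -
      K.μ a (E.matching M t ω a)) P :=
    fun t => (integrable_const _).sub (integrable_μ_matching E M t a)
  -- The count of mistakes carries `2 * (α / (α - 2))`, and the extra factor `N` of the bound
  -- absorbs this 2 only when `N ≥ 2`. With at most one user, every feasible matching is stable and
  -- the regret is nonpositive.
  rcases le_or_gt N 1 with hN | hN
  · refine le_trans (Finset.sum_nonpos fun t ht => ?_) (by positivity)
    refine integral_nonpos fun ω => ?_
    have h := (pessimalMatching_spec E M t a).2 _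
      (mem_stableSet_of_feasible_of_le_one hN K.μ (hIC' t ht ω).1)
    simpa using h
  · have hN' : (2 : ℝ) ≤ N := by exact_mod_cast hN
    calc _ ≤ ∑ t ∈ Icc 1 T, K.gapMax a * P.real (mistake E M t) := by
          refine Finset.sum_le_sum fun t ht => ?_
          have h := integral_le_of_forall_notMem (hint t) (measurableSet_mistake E M t)
            (A := 0) (C := K.gapMax a) (fun ω hω => ?_) (fun ω => ?_)
          · simpa using h
          · have h := (pessimalMatching_spec E M t a).2 _
              (mem_stableSet_of_notMem_mistake E M (hIC' t ht ω) hω)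
            simpa using h
          · simpa using K.sub_le_gapMax a _ _
      _ = K.gapMax a * ∑ t ∈ Icc 1 T, P.real (mistake E M t) := by rw [Finset.mul_sum]
      _ ≤ K.gapMax a * (2 * (N : ℝ) * L * (c + 2 * (E.α / (E.α - 2)))) := by
          gcongr
          exact sum_measure_mistake_le E M T
      _ ≤ K.gapMax a * (2 * (N : ℝ) * L * (N * (c + E.α / (E.α - 2)))) := by
          gcongr
          have h1 : 0 ≤ E.α / (E.α - 2) := by positivity
          nlinarith
      _ = _ := by ring

end Rewards

/-! ### A market with two stable matchings -/

/-- The values of the providers for the users. -/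
def userValue : Fin 3 → Fin 3 → ℝ := ![![1, 2, 100], ![2, 1, 3], ![1, 2, 3]]

/-- The values of the users for the providers. -/
def providerValue : Fin 3 → Fin 3 → ℝ := ![![3, 2, 1], ![2, 3, 1], ![1, 2, 3]]

theorem userValue_values :
    userValue 0 0 = 1 ∧ userValue 0 1 = 2 ∧ userValue 0 2 = 100 ∧
    userValue 1 0 = 2 ∧ userValue 1 1 = 1 ∧ userValue 1 2 = 3 ∧
    userValue 2 0 = 1 ∧ userValue 2 1 = 2 ∧ userValue 2 2 = 3 :=
  ⟨rfl, rfl, rfl, rfl, rfl, rfl, rfl, rfl, rfl⟩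

theorem providerValue_values :
    providerValue 0 0 = 3 ∧ providerValue 0 1 = 2 ∧ providerValue 0 2 = 1 ∧
    providerValue 1 0 = 2 ∧ providerValue 1 1 = 3 ∧ providerValue 1 2 = 1 ∧
    providerValue 2 0 = 1 ∧ providerValue 2 1 = 2 ∧ providerValue 2 2 = 3 :=
  ⟨rfl, rfl, rfl, rfl, rfl, rfl, rfl, rfl, rfl⟩

/-- The first two users disagree with the first two providers on how to pair up, and they all
would prefer the third provider, who is happy with the third user. -/
noncomputable def conflictMarket : Market 3 3 where
  le := le_rfl
  μ
    | Sum.inl u => fun b => b.elim 0 (userValue u)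
    | Sum.inr p => fun b => b.elim 0 (providerValue p)
  μ_nonneg := by
    rintro (u | p) (_ | b)
    · exact le_rfl
    · change 0 ≤ userValue u b
      fin_cases u <;> fin_cases b <;> simp [userValue]
    · exact le_rfl
    · change 0 ≤ providerValue p b
      fin_cases p <;> fin_cases b <;> simp [providerValue]
  μ_none := by rintro (u | p) <;> rfl
  μ_injective := by
    rintro (u | p)
    · have h : ∀ u, Function.Injective (fun b : Option (Fin 3) => b.elim 0 (userValue u)) := by
        intro u b c
        fin_cases u <;> fin_cases b <;> fin_cases c <;> simp [userValue]
      exact h u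
    · have h : ∀ p, Function.Injective (fun b : Option (Fin 3) => b.elim 0 (providerValue p)) := by
        intro u b c
        fin_cases u <;> fin_cases b <;> fin_cases c <;> simp [providerValue]
      exact h p

theorem conflictMarket_le (a : Agent 3 3) (b : Option (Partner a)) :
    conflictMarket.μ a b ≤ 100 := by
  rcases b with _ | b
  · rw [conflictMarket.μ_none]
    norm_num
  · rcases a with u | p
    · change userValue u b ≤ 100
      fin_cases u <;> fin_cases b <;> norm_num [userValue]
    · change providerValue p b ≤ 100
      fin_cases p <;> fin_cases b <;> norm_num [providerValue]

/-- The matching given by a permutation. -/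
def permMatching {n : ℕ} (π : Equiv.Perm (Fin n)) : Assignment n n
  | Sum.inl u => some (π u)
  | Sum.inr p => some (π.symm p)

theorem permMatching_user {n : ℕ} (π : Equiv.Perm (Fin n)) (u : Fin n) :
    permMatching π (Sum.inl u) = some (π u) := rfl

theorem permMatching_provider {n : ℕ} (π : Equiv.Perm (Fin n)) (p : Fin n) :
    permMatching π (Sum.inr p) = some (π.symm p) := rfl

theorem feasible_permMatching {n : ℕ} (π : Equiv.Perm (Fin n)) : Feasible (permMatching π) := by
  refine ⟨fun u p => ?_, fun p => by simp [permMatching_provider]⟩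
  rw [permMatching_user, permMatching_provider, Option.some_inj, Option.some_inj,
    Equiv.symm_apply_eq, eq_comm]

theorem Feasible.exists_perm {n : ℕ} {m : Assignment n n} (hm : Feasible m) :
    ∃ π, m = permMatching π := by
  have h : ∀ p : Fin n, ∃ u : Fin n, m (Sum.inr p) = some u :=
    fun p => Option.ne_none_iff_exists'.1 (hm.2 p)
  choose f hf using h
  have hinj : Function.Injective f := fun p p' h => by
    have h1 := (hm.1 _ _).2 (hf p)
    have h2 := (hm.1 _ _).2 (hf p')
    rw [h] at h1
    exact Option.some.inj (h1.symm.trans h2)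
  let π := Equiv.ofBijective f (Finite.injective_iff_bijective.1 hinj)
  refine ⟨π.symm, ?_⟩
  funext a
  rcases a with u | p
  · refine (hm.1 _ _).2 ((hf _).trans ?_)
    exact congrArg some (π.apply_symm_apply u)
  · exact hf p

theorem permMatching_mem_stableSet {n : ℕ} (V : Pref n n) (π : Equiv.Perm (Fin n)) :
    permMatching π ∈ stableSet V ↔ ∀ u p : Fin n,
      V (Sum.inl u) (some p) ≤ V (Sum.inl u) (some (π u)) ∨
        V (Sum.inr p) (some u) ≤ V (Sum.inr p) (some (π.symm p)) := by
  refine ⟨fun h u p => ?_, fun h => ⟨feasible_permMatching π, fun u p hb => ?_⟩⟩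
  · have := h.2 u p
    rwa [Blocks, not_and_or, not_lt, not_lt] at this
  · rcases h u p with h | h
    · exact absurd hb.1 (not_lt.2 h)
    · exact absurd hb.2 (not_lt.2 h)

theorem conflictMarket_user_perm (π : Equiv.Perm (Fin 3)) (u : Fin 3) :
    conflictMarket.μ (Sum.inl u) (permMatching π (Sum.inl u)) = userValue u (π u) := rfl

theorem conflictMarket_provider_perm (π : Equiv.Perm (Fin 3)) (p : Fin 3) :
    conflictMarket.μ (Sum.inr p) (permMatching π (Sum.inr p)) = providerValue p (π.symm p) := rfl

theorem permMatching_mem_conflictMarket (π : Equiv.Perm (Fin 3)) :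
    permMatching π ∈ stableSet conflictMarket.μ ↔ ∀ u p : Fin 3,
      userValue u p ≤ userValue u (π u) ∨ providerValue p u ≤ providerValue p (π.symm p) :=
  permMatching_mem_stableSet _ _

/-- User 2 and provider 2 rank each other first, so they would block any matching that separates
them; only two permutations fix 2, and both are stable. -/
theorem conflictMarket_stableSet : stableSet conflictMarket.μ =
    {permMatching 1, permMatching (Equiv.swap 0 1)} := by
  ext m
  simp only [Set.mem_insert_iff, Set.mem_singleton_iff]
  constructor
  · intro hm
    obtain ⟨π, rfl⟩ := hm.1.exists_perm
    rw [permMatching_mem_conflictMarket] at hm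
    have h2 : π 2 = 2 := by
      have h := hm 2 2
      rcases h with h | h
      · generalize π 2 = q at h ⊢
        fin_cases q <;> first | rfl | (exfalso; norm_num [userValue_values] at h)
      · rw [← Equiv.eq_symm_apply]
        generalize π.symm 2 = q at h ⊢
        fin_cases q <;> first | rfl | (exfalso; norm_num [providerValue_values] at h)
    have h : π = 1 ∨ π = Equiv.swap 0 1 := by
      clear hm
      revert h2
      revert π
      decide
    rcases h with rfl | rfl <;> simp
  · rintro (rfl | rfl)
    · rw [permMatching_mem_conflictMarket]
      have hone : Equiv.symm (1 : Equiv.Perm (Fin 3)) = 1 := rfl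
      intro u p
      fin_cases u <;> fin_cases p <;>
        simp only [Fin.zero_eta, Fin.mk_one, Fin.reduceFinMk, hone, Equiv.Perm.one_apply] <;>
        norm_num [userValue_values, providerValue_values]
    · rw [permMatching_mem_conflictMarket]
      intro u p
      simp only [Equiv.symm_swap]
      have h0 : Equiv.swap (0 : Fin 3) 1 0 = 1 := by decide
      have h1 : Equiv.swap (0 : Fin 3) 1 1 = 0 := by decide
      have h2 : Equiv.swap (0 : Fin 3) 1 2 = 2 := by decide
      fin_cases u <;> fin_cases p <;>
        simp only [Fin.zero_eta, Fin.mk_one, Fin.reduceFinMk, h0, h1, h2] <;>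
        norm_num [userValue_values, providerValue_values]

theorem conflictMarket_ncard : (stableSet conflictMarket.μ).ncard = 2 := by
  rw [conflictMarket_stableSet, Set.ncard_pair]
  intro h
  have h2 := congrFun h (Sum.inl 0)
  rw [permMatching_user, permMatching_user] at h2
  exact absurd (Option.some.inj h2) (by decide)

/-- The output of the Gale–Shapley algorithm is the provider-optimal matching when the reported
preferences agree with the true ones on the matches that improve on the output. -/
theorem conflictMarket_isGSOutput {V : Pref 3 3} {m : Assignment 3 3} (h : IsGSOutput V m)
    (hV : ∀ a c, conflictMarket.μ a (m a) < conflictMarket.μ a c → V a (m a) < V a c) :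
    m = permMatching 1 := by
  have hst := h.mem_stableSet
  have hm : m ∈ stableSet conflictMarket.μ :=
    ⟨hst.1, fun u p hb => hst.2 u p ⟨hV _ _ hb.1, hV _ _ hb.2⟩⟩
  rw [conflictMarket_stableSet] at hm
  rcases hm with hm | hm
  · exact hm
  exfalso
  rw [Set.mem_singleton_iff] at hm
  have hu0 : m (Sum.inl 0) = some 1 := by rw [hm]; decide
  have hu1 : m (Sum.inl 1) = some 0 := by rw [hm]; decide
  have hp0 : m (Sum.inr 0) = some 1 := by rw [hm]; decide
  have hp1 : m (Sum.inr 1) = some 0 := by rw [hm]; decide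
  have hV0 : V (Sum.inl 0) (some 1) < V (Sum.inl 0) (some 2) := by
    rw [← hu0]
    refine hV _ _ ?_
    rw [hu0]
    change userValue 0 1 < userValue 0 2
    norm_num [userValue_values]
  have hV1 : V (Sum.inl 1) (some 0) < V (Sum.inl 1) (some 2) := by
    rw [← hu1]
    refine hV _ _ ?_
    rw [hu1]
    change userValue 1 0 < userValue 1 2
    norm_num [userValue_values]
  have hV2 : V (Sum.inr 0) (some 1) < V (Sum.inr 0) (some 0) := by
    rw [← hp0]
    refine hV _ _ ?_
    rw [hp0]
    change providerValue 0 1 < providerValue 0 0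
    norm_num [providerValue_values]
  have hV3 : V (Sum.inr 1) (some 0) < V (Sum.inr 1) (some 1) := by
    rw [← hp1]
    refine hV _ _ ?_
    rw [hp1]
    change providerValue 1 0 < providerValue 1 1
    norm_num [providerValue_values]
  obtain ⟨Q₀, Q, hQ₀, hrun, -⟩ := h
  have I := (GSInvariant.init hQ₀).run hrun
  -- Users 0 and 1 report provider 2 above their final match, so provider 2 never proposed to them.
  have hQ0 : (0 : Fin 3) ∈ Q 2 := by
    by_contra hq
    obtain ⟨p, h1, h2⟩ := I.proposed 0 2 hq
    cases hu0.symm.trans h1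
    exact absurd hV0 (not_lt.2 h2)
  have hQ1 : (1 : Fin 3) ∈ Q 2 := by
    by_contra hq
    obtain ⟨p, h1, h2⟩ := I.proposed 1 2 hq
    cases hu1.symm.trans h1
    exact absurd hV1 (not_lt.2 h2)
  -- Providers 0 and 1 are thus the only possible rivals for users 0 and 1, and each prefers the
  -- user of its own index; so provider 0 is never turned down by user 0, contrary to its match with
  -- user 1.
  have key := mem_queue_or_match_of_run (A := {0, 1}) (f := id) (GSInvariant.init hQ₀)
    (fun p u => (hQ₀ p).2.1 u) hrun (by
      rintro p (rfl | rfl) p' hp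
      · fin_cases p'
        · exact absurd rfl hp
        · exact Or.inr ⟨Or.inr rfl, hV3⟩
        · exact Or.inl hQ0
      · fin_cases p'
        · exact Or.inr ⟨Or.inl rfl, hV2⟩
        · exact absurd rfl hp
        · exact Or.inl hQ1) 0 (Or.inl rfl)
  rcases key with h1 | h1
  · exact absurd hV2 (not_lt.2 (I.match_le 1 0 hp0 0 h1))
  · cases hp0.symm.trans h1

/-! ### Growth of the regret in the conflict market -/

section Rewards

variable {Ω : Type*} [mΩ : MeasurableSpace Ω] {P : Measure Ω}

theorem exists_sum_mistake_le {N L : ℕ} {K : Market N L} [IsProbabilityMeasure P]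
    (E : Environment K P) (M : Mechanism N L) :
    ∃ A B : ℝ, ∀ T : ℕ, ∑ t ∈ Icc 1 T, P.real (mistake E M t) ≤ A * Real.log T + B := by
  refine ⟨2 * (N : ℝ) * L * (8 * (E.σ : ℝ) ^ 2 * E.α / K.gapMin ^ 2),
    2 * (N : ℝ) * L * (2 * (E.α / (E.α - 2))), fun T => (sum_measure_mistake_le E M T).trans ?_⟩
  refine le_of_eq ?_
  ring

theorem isLittleO_log_add (A B : ℝ) :
    (fun T : ℕ => A * Real.log T + B) =o[atTop] fun T : ℕ => (T : ℝ) := by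
  have h1 : (fun T : ℕ => Real.log T) =o[atTop] fun T : ℕ => (T : ℝ) :=
    Real.isLittleO_log_id_atTop.comp_tendsto tendsto_natCast_atTop_atTop
  refine (h1.const_mul_left A).add ?_
  exact (Asymptotics.isLittleO_const_id_atTop B).comp_tendsto tendsto_natCast_atTop_atTop

theorem eventually_sum_mistake_le {N L : ℕ} {K : Market N L} [IsProbabilityMeasure P]
    (E : Environment K P) (M : Mechanism N L) {c : ℝ} (hc : 0 < c) :
    ∀ᶠ T : ℕ in atTop, ∑ t ∈ Icc 1 T, P.real (mistake E M t) ≤ c * T := by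
  obtain ⟨A, B, hAB⟩ := exists_sum_mistake_le E M
  filter_upwards [(isLittleO_log_add A B).def hc] with T hT
  refine (hAB T).trans ((le_abs_self _).trans ?_)
  simpa using hT

theorem IsOmegaLinear.isLittleOmegaLog {f : ℕ → ℝ} (hf : IsOmegaLinear f) :
    IsLittleOmegaLog f := by
  intro A
  obtain ⟨c, hc, h⟩ := hf
  filter_upwards [h, (isLittleO_log_add A 0).def hc] with T h1 h2
  refine le_trans ?_ h1
  have := (le_abs_self _).trans h2
  simpa using this

theorem isBigOLog_of_abs_le {f : ℕ → ℝ} {A B : ℝ}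
    (hf : ∀ T : ℕ, |f T| ≤ A * Real.log T + B) : IsBigOLog f := by
  have h1 : (fun T : ℕ => A * Real.log T + B) =O[atTop] fun T : ℕ => Real.log T := by
    refine (Asymptotics.isBigO_const_mul_self A _ _).add ?_
    exact ((Asymptotics.isLittleO_const_left.2 (Or.inr (tendsto_norm_atTop_atTop.comp
      (Real.tendsto_log_atTop.comp tendsto_natCast_atTop_atTop))))).isBigO
  exact (Asymptotics.isBigO_of_le _ fun T => (hf T).trans (le_abs_self _)).trans h1

theorem integral_ge_of_forall_notMem [IsProbabilityMeasure P] {D : Ω → ℝ} (hD : Integrable D P)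
    {B : Set Ω} (hB : MeasurableSet B) {A C : ℝ} (h1 : ∀ ω ∉ B, A ≤ D ω)
    (h2 : ∀ ω, A - C ≤ D ω) : A - C * P.real B ≤ ∫ ω, D ω ∂P := by
  have h := integral_le_of_forall_notMem hD.neg hB (A := -A) (C := C)
    (fun ω hω => neg_le_neg (h1 ω hω)) fun ω => by
      have := h2 ω
      simp only [Pi.neg_apply]
      linarith
  simp only [Pi.neg_apply, integral_neg] at h
  linarith

theorem conflictMarket_optimal (E : Environment conflictMarket P) (M : Mechanism 3 3) (t : ℕ)
    (a : Agent 3 3) :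
    conflictMarket.μ a (optimalMatching E zeroRule zeroRule M t a a) =
      max (conflictMarket.μ a (permMatching 1 a))
        (conflictMarket.μ a (permMatching (Equiv.swap 0 1) a)) := by
  obtain ⟨h1, h2⟩ := optimalMatching_spec E M t a
  rw [conflictMarket_stableSet] at h1 h2
  refine le_antisymm ?_ (max_le (h2 _ (Or.inl rfl)) (h2 _ (Or.inr rfl)))
  rcases h1 with h1 | h1
  · rw [h1]
    exact le_max_left _ _
  · rw [Set.mem_singleton_iff.1 h1]
    exact le_max_right _ _

theorem conflictMarket_values :
    conflictMarket.μ (Sum.inl 0) (permMatching 1 (Sum.inl 0)) = 1 ∧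
    conflictMarket.μ (Sum.inl 0) (permMatching (Equiv.swap 0 1) (Sum.inl 0)) = 2 ∧
    conflictMarket.μ (Sum.inr 0) (permMatching 1 (Sum.inr 0)) = 3 ∧
    conflictMarket.μ (Sum.inr 0) (permMatching (Equiv.swap 0 1) (Sum.inr 0)) = 2 ∧
    conflictMarket.μ (Sum.inl 2) (permMatching 1 (Sum.inl 2)) = 3 ∧
    conflictMarket.μ (Sum.inl 2) (permMatching (Equiv.swap 0 1) (Sum.inl 2)) = 3 := by
  have hone : Equiv.symm (1 : Equiv.Perm (Fin 3)) = 1 := rfl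
  have h0 : Equiv.swap (0 : Fin 3) 1 0 = 1 := by decide
  have h2 : Equiv.swap (0 : Fin 3) 1 2 = 2 := by decide
  simp only [conflictMarket_user_perm, conflictMarket_provider_perm, Equiv.symm_swap, h0, h2,
    hone, Equiv.Perm.one_apply]
  norm_num [userValue_values, providerValue_values]

theorem conflictMarket_matching_of_appliesGS {E : Environment conflictMarket P}
    {M : Mechanism 3 3} (hGS : ∀ T, AppliesGS E zeroRule zeroRule M T) {t : ℕ} (ht : 1 ≤ t)
    {ω : Ω} (hω : ω ∉ mistake E M t) : E.matching M t ω = permMatching 1 := by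
  have h := hGS t t (Finset.mem_Icc.2 ⟨ht, le_rfl⟩) ω
  rw [payoff_zeroRule] at h
  exact conflictMarket_isGSOutput h fun a c hc => lt_of_notMem_mistake E M hω hc

theorem conflictMarket_matching_of_ic {E : Environment conflictMarket P}
    {M : Mechanism 3 3} (hIC : ∀ T, IncentiveCompatible E zeroRule zeroRule M T) {t : ℕ}
    (ht : 1 ≤ t) {ω : Ω} (hω : ω ∉ mistake E M t) :
    E.matching M t ω = permMatching 1 ∨ E.matching M t ω = permMatching (Equiv.swap 0 1) := by
  have h := hIC t t (Finset.mem_Icc.2 ⟨ht, le_rfl⟩) ω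
  rw [payoff_zeroRule] at h
  have h2 := mem_stableSet_of_notMem_mistake E M h hω
  rwa [conflictMarket_stableSet] at h2

theorem conflictMarket_isOmegaLinear [IsProbabilityMeasure P] (E : Environment conflictMarket P)
    (M : Mechanism 3 3) (hGS : ∀ T, AppliesGS E zeroRule zeroRule M T) :
    IsOmegaLinear (optimalRegret E zeroRule zeroRule M (Sum.inl 0)) := by
  obtain ⟨v1, v2, -⟩ := conflictMarket_values
  refine ⟨1 / 2, by norm_num, ?_⟩
  -- Each round costs user 0 a loss of 1 outside mistakes. A mistake may be profitable, by at most
  -- 98 since values are at most 100, so it is charged 100; `1 / 200` leaves half of `T`.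
  filter_upwards [eventually_sum_mistake_le E M (c := 1 / 200) (by norm_num)] with T hT
  rw [optimalRegret, integral_regret]
  calc 1 / 2 * (T : ℝ) ≤ ∑ t ∈ Icc 1 T, (1 - 100 * P.real (mistake E M t)) := by
        rw [Finset.sum_sub_distrib, ← Finset.mul_sum, Finset.sum_const, Nat.card_Icc]
        simp only [Nat.add_sub_cancel, nsmul_eq_mul, mul_one]
        linarith
    _ ≤ _ := by
        refine Finset.sum_le_sum fun t ht => ?_
        refine integral_ge_of_forall_notMem
          ((integrable_const _).sub (integrable_μ_matching E M t _))
          (measurableSet_mistake E M t) (fun ω hω => ?_) (fun ω => ?_)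
        · rw [conflictMarket_optimal, v1, v2, Pi.sub_apply,
            conflictMarket_matching_of_appliesGS hGS (Finset.mem_Icc.1 ht).1 hω, v1]
          norm_num
        · have := conflictMarket_le (Sum.inl 0) (E.matching M t ω (Sum.inl 0))
          rw [conflictMarket_optimal, v1, v2, Pi.sub_apply]
          norm_num
          linarith

/-- User 2 gets the value 3 in both stable matchings, so only mistakes contribute. -/
theorem conflictMarket_isBigOLog [IsProbabilityMeasure P] (E : Environment conflictMarket P)
    (M : Mechanism 3 3) (hGS : ∀ T, AppliesGS E zeroRule zeroRule M T) :
    IsBigOLog (optimalRegret E zeroRule zeroRule M (Sum.inl 2)) := by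
  obtain ⟨-, -, -, -, v5, v6⟩ := conflictMarket_values
  obtain ⟨A, B, hAB⟩ := exists_sum_mistake_le E M
  refine isBigOLog_of_abs_le (A := 100 * A) (B := 100 * B) fun T => ?_
  have hint : ∀ t, Integrable (fun ω => conflictMarket.μ (Sum.inl 2)
      (optimalMatching E zeroRule zeroRule M t (Sum.inl 2) (Sum.inl 2)) -
        conflictMarket.μ (Sum.inl 2) (E.matching M t ω (Sum.inl 2))) P :=
    fun t => (integrable_const _).sub (integrable_μ_matching E M t _)
  have h0 : ∀ t ∈ Icc 1 T, ∀ ω ∉ mistake E M t, conflictMarket.μ (Sum.inl 2)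
      (optimalMatching E zeroRule zeroRule M t (Sum.inl 2) (Sum.inl 2)) -
        conflictMarket.μ (Sum.inl 2) (E.matching M t ω (Sum.inl 2)) = 0 := by
    intro t ht ω hω
    rw [conflictMarket_optimal, v5, v6,
      conflictMarket_matching_of_appliesGS hGS (Finset.mem_Icc.1 ht).1 hω, v5]
    norm_num
  have h1 : ∀ t ω, |conflictMarket.μ (Sum.inl 2)
      (optimalMatching E zeroRule zeroRule M t (Sum.inl 2) (Sum.inl 2)) -
        conflictMarket.μ (Sum.inl 2) (E.matching M t ω (Sum.inl 2))| ≤ 100 := by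
    intro t ω
    have h2 := conflictMarket_le (Sum.inl 2) (E.matching M t ω (Sum.inl 2))
    have h3 := conflictMarket.μ_nonneg (Sum.inl 2) (E.matching M t ω (Sum.inl 2))
    rw [conflictMarket_optimal, v5, v6, max_self, abs_le]
    constructor <;> linarith
  rw [optimalRegret, integral_regret]
  calc _ ≤ ∑ t ∈ Icc 1 T, 100 * P.real (mistake E M t) := by
        refine (Finset.abs_sum_le_sum_abs _ _).trans (Finset.sum_le_sum fun t ht => ?_)
        rw [abs_le]
        have h2 := integral_le_of_forall_notMem (hint t) (measurableSet_mistake E M t)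
          (A := 0) (C := 100) (fun ω hω => (h0 t ht ω hω).le)
          fun ω => by simpa using (abs_le.1 (h1 t ω)).2
        have h3 := integral_ge_of_forall_notMem (hint t) (measurableSet_mistake E M t)
          (A := 0) (C := 100) (fun ω hω => (h0 t ht ω hω).ge)
          fun ω => by simpa using (abs_le.1 (h1 t ω)).1
        constructor <;> linarith
    _ = 100 * ∑ t ∈ Icc 1 T, P.real (mistake E M t) := by rw [Finset.mul_sum]
    _ ≤ 100 * (A * Real.log T + B) := by gcongr; exact hAB T
    _ = _ := by ring

theorem conflictMarket_unfair [IsProbabilityMeasure P] (E : Environment conflictMarket P)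
    (M : Mechanism 3 3) (hGS : ∀ T, AppliesGS E zeroRule zeroRule M T) :
    Unfair E zeroRule zeroRule M :=
  ⟨{Sum.inl 2}, by simp, by simp, Sum.inl 2, by simp, Sum.inl 0, by simp,
    conflictMarket_isBigOLog E M hGS, (conflictMarket_isOmegaLinear E M hGS).isLittleOmegaLog⟩

/-- In either stable matching exactly one of user 0 and provider 0 is 1 below its optimum. The
mechanism may alternate between the two matchings, so only the sum of the two regrets is controlled
and the losing agent may depend on `T`. -/
theorem conflictMarket_ic_regret [IsProbabilityMeasure P] (E : Environment conflictMarket P)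
    (M : Mechanism 3 3) (hIC : ∀ T, IncentiveCompatible E zeroRule zeroRule M T) :
    ∃ c : ℝ, 0 < c ∧ ∀ᶠ T : ℕ in atTop,
      ∃ a, c * T ≤ optimalRegret E zeroRule zeroRule M a T := by
  obtain ⟨v1, v2, v3, v4, -⟩ := conflictMarket_values
  refine ⟨1 / 4, by norm_num, ?_⟩
  -- A mistake is charged 100 for each of the two agents; the sum of regrets keeps `T / 2`, so one
  -- of them has at least `T / 4`.
  filter_upwards [eventually_sum_mistake_le E M (c := 1 / 400) (by norm_num)] with T hT
  have h : 1 / 2 * (T : ℝ) ≤ optimalRegret E zeroRule zeroRule M (Sum.inl 0) T +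
      optimalRegret E zeroRule zeroRule M (Sum.inr 0) T := by
    have hint : ∀ t a, Integrable (fun ω => conflictMarket.μ a
        (optimalMatching E zeroRule zeroRule M t a a) -
          conflictMarket.μ a (E.matching M t ω a)) P :=
      fun t a => (integrable_const _).sub (integrable_μ_matching E M t _)
    rw [optimalRegret, optimalRegret, integral_regret, integral_regret,
      ← Finset.sum_add_distrib]
    calc 1 / 2 * (T : ℝ) ≤ ∑ t ∈ Icc 1 T, (1 - 200 * P.real (mistake E M t)) := by
          rw [Finset.sum_sub_distrib, ← Finset.mul_sum, Finset.sum_const, Nat.card_Icc]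
          simp only [Nat.add_sub_cancel, nsmul_eq_mul, mul_one]
          linarith
      _ ≤ _ := by
          refine Finset.sum_le_sum fun t ht => ?_
          rw [← integral_add (hint t _) (hint t _)]
          refine integral_ge_of_forall_notMem ((hint t _).add (hint t _))
            (measurableSet_mistake E M t) (fun ω hω => ?_) (fun ω => ?_)
          · rw [conflictMarket_optimal, conflictMarket_optimal, v1, v2, v3, v4, Pi.add_apply]
            rcases conflictMarket_matching_of_ic hIC (Finset.mem_Icc.1 ht).1 hω with h | h
            · rw [h, v1, v3]
              norm_num
            · rw [h, v2, v4]
              norm_num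
          · have h1 := conflictMarket_le (Sum.inl 0) (E.matching M t ω (Sum.inl 0))
            have h2 := conflictMarket_le (Sum.inr 0) (E.matching M t ω (Sum.inr 0))
            rw [conflictMarket_optimal, conflictMarket_optimal, v1, v2, v3, v4, Pi.add_apply]
            norm_num
            linarith
  by_contra! hcon
  have h1 := hcon (Sum.inl 0)
  have h2 := hcon (Sum.inr 0)
  linarith

end Rewards

/-! ### Deterministic rewards -/

/-- The environment in which all rewards are equal to their means. -/
noncomputable def deterministicEnvironment {N L : ℕ} (K : Market N L) (σ : ℝ≥0) {α : ℝ}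
    (hα : 2 < α) {T₀ : Fin N → Fin L → ℕ} (hT₀ : ∀ u p, 0 < T₀ u p) :
    Environment K (Measure.dirac ()) where
  σ := σ
  α := α
  two_lt_α := hα
  T₀ := T₀
  T₀_pos := hT₀
  D a b := Measure.dirac (K.μ a (some b))
  mean_D a b := by simp
  subgaussian_D a b :=
    { integrable_exp_mul := fun t => integrable_dirac (by simp)
      mgf_le := fun t => by
        simp only [mgf, integral_dirac, sub_self, mul_zero, Real.exp_zero]
        exact Real.one_le_exp (by positivity) }
  X₀ _ a b _ := K.μ a (some b)
  X _ a b _ := K.μ a (some b)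
  measurable_X₀ _ _ _ := measurable_const
  measurable_X _ _ _ := measurable_const
  law_X₀ _ _ _ := by simp
  law_X _ _ _ := by simp
  indep := by
    rw [iIndepFun_iff_measure_inter_preimage_eq_mul]
    intro S sets _
    simp only [Measure.dirac_apply]
    -- Both sides equal 1 if every constant lies in its set, and 0 otherwise.
    by_cases h : ∀ i ∈ S, () ∈ (fun _ : Unit => K.μ i.2.1 (some i.2.2)) ⁻¹' sets i
    · have h' : ∀ i ∈ S, () ∈ Sum.elim (fun (_ : ℕ) (a : Agent N L) (b : Partner a) (_ : Unit) =>
          K.μ a (some b)) (fun _ a b _ => K.μ a (some b)) i.1 i.2.1 i.2.2 ⁻¹' sets i := by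
        rintro ⟨_ | _, a, b⟩ hi <;> exact h _ hi
      rw [Set.indicator_of_mem (Set.mem_iInter₂.2 h'),
        Finset.prod_congr rfl fun i hi => Set.indicator_of_mem (h' i hi) 1]
      simp
    · push Not at h
      obtain ⟨i, hi, hi'⟩ := h
      have h' : () ∉ Sum.elim (fun (_ : ℕ) (a : Agent N L) (b : Partner a) (_ : Unit) =>
          K.μ a (some b)) (fun _ a b _ => K.μ a (some b)) i.1 i.2.1 i.2.2 ⁻¹' sets i := by
        obtain ⟨_ | _, a, b⟩ := i <;> exact hi'
      rw [Set.indicator_of_notMem fun h => h' (Set.mem_iInter₂.1 h i hi),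
        Finset.prod_eq_zero hi (Set.indicator_of_notMem h' 1)]

/-- Sample means are exact, and `log 1 = 0` removes the confidence width at time 1. -/
theorem ν_one_deterministicEnvironment {N L : ℕ} (K : Market N L) (σ : ℝ≥0) {α : ℝ}
    (hα : 2 < α) {T₀ : Fin N → Fin L → ℕ} (hT₀ : ∀ u p, 0 < T₀ u p) (M : Mechanism N L)
    (ω : Unit) : (deterministicEnvironment K σ hα hT₀).ν M 1 ω = K.μ := by
  funext a b
  rcases b with _ | b
  · exact (K.μ_none a).symm
  · rw [ν_some]
    have h1 : deviation (deterministicEnvironment K σ hα hT₀) M (1 - 1) a b ω = 0 := by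
      simp [deviation, Environment.stats, deterministicEnvironment, mul_comm]
    rw [h1, width]
    simp

/-! ### Social welfare in the conflict market -/

theorem le_maxWelfare {N L : ℕ} (V : Pref N L) {m : Assignment N L} (hm : Feasible m) :
    welfare V m ≤ maxWelfare V := by
  refine le_csSup (Set.Finite.bddAbove ?_) ⟨m, hm, rfl⟩
  refine (Set.finite_range (welfare V)).subset ?_
  rintro d ⟨m, -, rfl⟩
  exact ⟨m, rfl⟩

theorem conflictMarket_welfare (π : Equiv.Perm (Fin 3)) :
    welfare conflictMarket.μ (permMatching π) =
      ∑ u, userValue u (π u) + ∑ p, providerValue p (π.symm p) := by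
  rw [welfare, Fintype.sum_sum_type]
  rfl

theorem conflictMarket_not_highWelfare (σ : ℝ≥0) {α : ℝ} (hα : 2 < α) {T₀ : Fin 3 → Fin 3 → ℕ}
    (hT₀ : ∀ u p, 0 < T₀ u p) (M : Mechanism 3 3) {T : ℕ} (hT : 1 ≤ T)
    (hIC : IncentiveCompatible (deterministicEnvironment conflictMarket σ hα hT₀)
      zeroRule zeroRule M T) (ω : Unit) :
    ¬ HighWelfare (deterministicEnvironment conflictMarket σ hα hT₀) zeroRule zeroRule M T ω := by
  intro h
  have h1 := h 1 (Finset.mem_Icc.2 ⟨le_rfl, hT⟩)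
  have h2 := hIC 1 (Finset.mem_Icc.2 ⟨le_rfl, hT⟩) ω
  rw [payoff_zeroRule, ν_one_deterministicEnvironment] at h1 h2
  -- Giving provider 2 to user 0 yields welfare 107, while both stable matchings have welfare 14,
  -- less than half of it.
  have h3 := le_maxWelfare conflictMarket.μ (feasible_permMatching (Equiv.swap (0 : Fin 3) 2))
  have hone : Equiv.symm (1 : Equiv.Perm (Fin 3)) = 1 := rfl
  have e0 : Equiv.swap (0 : Fin 3) 2 0 = 2 := by decide
  have e1 : Equiv.swap (0 : Fin 3) 2 1 = 1 := by decide
  have e2 : Equiv.swap (0 : Fin 3) 2 2 = 0 := by decide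
  have f0 : Equiv.swap (0 : Fin 3) 1 0 = 1 := by decide
  have f1 : Equiv.swap (0 : Fin 3) 1 1 = 0 := by decide
  have f2 : Equiv.swap (0 : Fin 3) 1 2 = 2 := by decide
  simp only [conflictMarket_welfare, Fin.sum_univ_three, Equiv.symm_swap, e0, e1, e2] at h3
  norm_num [userValue_values, providerValue_values] at h3
  rw [conflictMarket_stableSet] at h2
  rcases h2 with h2 | h2
  · rw [h2] at h1
    simp only [conflictMarket_welfare, Fin.sum_univ_three, hone,
      Equiv.Perm.one_apply] at h1
    norm_num [userValue_values, providerValue_values] at h1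
    linarith
  · rw [Set.mem_singleton_iff.1 h2] at h1
    simp only [conflictMarket_welfare, Fin.sum_univ_three, Equiv.symm_swap, f0, f1, f2] at h1
    norm_num [userValue_values, providerValue_values] at h1
    linarith

end MatchingBandits

theorem proposition1 :
    -- incentive compatibility and logarithmic pessimal regret
    (∀ (N L : ℕ) (K : Market N L) (Ω : Type*) [MeasurableSpace Ω] (P : Measure Ω)
        [IsProbabilityMeasure P] (E : Environment K P) (M : Mechanism N L) (T : ℕ), 1 ≤ T →
      AppliesGS E zeroRule zeroRule M T →
        IncentiveCompatible E zeroRule zeroRule M T ∧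
        ∀ a : Agent N L, pessimalRegret E zeroRule zeroRule M a T ≤
          2 * (N : ℝ) ^ 2 * L * K.gapMax a *
            (8 * (E.σ : ℝ) ^ 2 * E.α * Real.log T / K.gapMin ^ 2 + E.α / (E.α - 2))) ∧
    -- a market with three users, three providers and two stable matchings
    ∃ K : Market 3 3, (stableSet (payoff zeroRule zeroRule K.μ)).ncard = 2 ∧
      -- the Gale–Shapley algorithm yields a mechanism
      (∃ M : Mechanism 3 3, ∀ ψ, IsGSOutput (payoff zeroRule zeroRule ψ) (M.toFun ψ)) ∧
      -- linear optimal regret and unfairness when the Gale–Shapley algorithm is applied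
      (∀ (Ω : Type*) [MeasurableSpace Ω] (P : Measure Ω) [IsProbabilityMeasure P]
          (E : Environment K P) (M : Mechanism 3 3),
        (∀ T, AppliesGS E zeroRule zeroRule M T) →
          (∃ a, IsOmegaLinear (optimalRegret E zeroRule zeroRule M a)) ∧
          Unfair E zeroRule zeroRule M) ∧
      -- linear worst optimal regret under incentive compatibility
      (∀ (Ω : Type*) [MeasurableSpace Ω] (P : Measure Ω) [IsProbabilityMeasure P]
          (E : Environment K P) (M : Mechanism 3 3),
        (∀ T, IncentiveCompatible E zeroRule zeroRule M T) →
          ∃ c : ℝ, 0 < c ∧ ∀ᶠ T : ℕ in atTop,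
            ∃ a, c * T ≤ optimalRegret E zeroRule zeroRule M a T) ∧
      -- no high social welfare under incentive compatibility
      (∀ (σ : ℝ≥0) (α : ℝ) (T₀ : Fin 3 → Fin 3 → ℕ), 2 < α → (∀ u p, 0 < T₀ u p) →
        ∃ (Ω : Type) (_ : MeasurableSpace Ω) (P : Measure Ω) (_ : IsProbabilityMeasure P)
          (E : Environment K P), E.σ = σ ∧ E.α = α ∧ E.T₀ = T₀ ∧
          ∀ (M : Mechanism 3 3) (T : ℕ), 1 ≤ T → IncentiveCompatible E zeroRule zeroRule M T →
            ∀ᵐ ω ∂P, ¬ HighWelfare E zeroRule zeroRule M T ω) := by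
  refine ⟨fun N L K Ω _ P _ E M T _ hGS => ⟨hGS.incentiveCompatible, fun a =>
    pessimalRegret_le E M T hGS.incentiveCompatible a⟩, conflictMarket, ?_, ?_, ?_, ?_, ?_⟩
  · rw [payoff_zeroRule]
    exact conflictMarket_ncard
  · simpa using exists_mechanism_isGSOutput (le_refl 3)
  · exact fun Ω _ P _ E M hGS =>
      ⟨⟨_, conflictMarket_isOmegaLinear E M hGS⟩, conflictMarket_unfair E M hGS⟩
  · exact fun Ω _ P _ E M hIC => conflictMarket_ic_regret E M hIC
  · exact fun σ α T₀ hα hT₀ => ⟨Unit, inferInstance, Measure.dirac (), inferInstance,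
      deterministicEnvironment conflictMarket σ hα hT₀, rfl, rfl, rfl, fun M T hT hIC =>
        ae_of_all _ fun ω => conflictMarket_not_highWelfare σ hα hT₀ M hT hIC ω⟩
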